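/- Let $\widetilde J=\begin{pmatrix}0&1\\-1&0\end{pmatrix}$, let $e_1,\dots,e_6$ be the canonical basis of $\mathbb R^6$, and for an orthogonal matrix $B$ and $b\in\mathbb R^6$ let $BL_b$ be the isometry $x\mapsto B(x+b)$ of $\mathbb R^6$; $L_b$ is the translation $x\mapsto x+b$. Put $$B_1=\operatorname{diag}(\widetilde J,\widetilde J,I_2),\quad B_2=\operatorname{diag}(-I_2,I_2,I_2),\quad B_1'=\operatorname{diag}(\widetilde J,1,-1,-1,1),\quad B_2'=\operatorname{diag}(-I_2,-1,1,-1,1),$$ $$\Gamma=\langle B_1L_{e_5/4},\ B_2L_{e_6/2},\ L_\lambda:\lambda\in\mathbb Z^6\rangle,\qquad \Gamma'=\langle B_1'L_{e_6/4},\ B_2'L_{(e_4+e_5)/2},\ L_\lambda:\lambda\in\mathbb Z^6\rangle .$$ For a Bieberbach group $G$ (a discrete, cocompact, torsion-free subgroup of the isometry group of $\mathbb R^n$) let $M_G=G\backslash\mathbb R^n$ be the associated compact flat manifold, with holonomy group $\{B: BL_b\in G\text{ for some }b\}$. Two such manifolds are called $p$-isospectral if every real number has the same multiplicity as an eigenvalue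 of the Hodge-Laplacian $d\delta+\delta d$ on smooth complex $p$-forms on the two manifolds (multiplicity $0$ if it is not an eigenvalue). If $G$ has translation lattice $\Lambda$ with dual lattice $\Lambda^*$ and $BL_b\in G$, put $$e_{\mu,B}(G)=\sum_{v\in\Lambda^*,\ \|v\|^2=\mu,\ Bv=v}e^{2\pi i\,v\cdot b}.$$ Then: 1. $\Gamma$ and $\Gamma'$ are Bieberbach groups with translation lattice $\mathbb Z^6$; they act freely and properly discontinuously on $\mathbb R^6$, with Hausdorff quotients $M_\Gamma$, $M_{\Gamma'}$. These $6$-dimensional compact flat manifolds are orientable, and both have holonomy group isomorphic to $\mathbb Z_4\times\mathbb Z_2$. 2. $\Gamma\not\cong\Gamma'$, and the fundamental groups of $M_\Gamma$ and $M_{\Gamma'}$ (at any base points) are not isomorphic. 3. $M_\Gamma$ and $M_{\Gamma'}$ are isospectral on functions and on $6$-forms, but for $1\le p\le 5$ they are not $p$-isospectral. 4. There is a bijection $\Phi$ from the holonomy group $F$ of $M_\Gamma$ onto that of $M_{\Gamma'}$ with $\Phi(B_1^iB_2^j)=B_1'^{\,i}B_2'^{\,j}$ if $i\in\{1,3\}$,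 $j\in\{0,1\}$ or $(i,j)=(2,1)$, with $\Phi(B_1^2)=B_2'$ and $\Phi(B_2)=B_1'^{\,2}$, such that $e_{\mu,B}(\Gamma)=e_{\mu,\Phi(B)}(\Gamma')$ for all $\mu\in\mathbb R$ and $B\in F$. Moreover $\sum_{B\in F,\ \operatorname{ord}B=4}e_{8,B}(\Gamma)=-16$. -/

import Mathlib

open scoped ContDiff

noncomputable section

/-! ### Isometries of Euclidean space and their subgroups -/

/-- Euclidean space `ℝⁿ`. -/
abbrev Euc (n : ℕ) : Type := EuclideanSpace ℝ (Fin n)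

/-- The group `I(ℝⁿ)` of isometries of `ℝⁿ`. -/
abbrev Isom (n : ℕ) : Type := Euc n ≃ᵃⁱ[ℝ] Euc n

instance isomMulAction (n : ℕ) : MulAction (Isom n) (Euc n) where
  smul g x := g x
  one_smul _ := rfl
  mul_smul _ _ _ := rfl

/-- The projection `I(ℝⁿ) → O(n)`, `B L_b ↦ B`. -/
def linearPart (n : ℕ) : Isom n →* (Euc n ≃ₗᵢ[ℝ] Euc n) where
  toFun g := g.linearIsometryEquiv
  map_one' := by ext x; rfl
  map_mul' g h := by ext x; rfl

/-- The translation `L_b : x ↦ x + b`. -/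
def translation {n : ℕ} (b : Euc n) : Isom n := AffineIsometryEquiv.constVAdd ℝ (Euc n) b

/-- The isometry `B L_b : x ↦ B (x + b)`. -/
def motion {n : ℕ} (B : Euc n ≃ₗᵢ[ℝ] Euc n) (b : Euc n) : Isom n :=
  B.toAffineIsometryEquiv * translation b

theorem motion_apply {n : ℕ} (B : Euc n ≃ₗᵢ[ℝ] Euc n) (b x : Euc n) :
    motion B b x = B (x + b) := by
  rw [add_comm]; rfl

/-- The linear isometry of `ℝⁿ` given by an orthogonal matrix acting on column vectors. -/
def orthogonalIsometry {n : ℕ} (A : Matrix.orthogonalGroup (Fin n) ℝ) : Euc n ≃ₗᵢ[ℝ] Euc n :=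
  Unitary.linearIsometryEquiv
    ⟨Matrix.toEuclideanCLM (n := Fin n) (𝕜 := ℝ) A.1, Unitary.map_mem _ A.2⟩

theorem orthogonalIsometry_apply {n : ℕ} (A : Matrix.orthogonalGroup (Fin n) ℝ) (x : Euc n) :
    orthogonalIsometry A x = WithLp.toLp 2 (A.1.mulVec x.ofLp) := by
  rfl

/-- The orbit space `M_Γ = Γ \ ℝⁿ`. -/
abbrev OrbitSpace {n : ℕ} (Γ : Subgroup (Isom n)) : Type := MulAction.orbitRel.Quotient Γ (Euc n)

/-- The projection `ℝⁿ → Γ \ ℝⁿ`. -/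
def orbitProj {n : ℕ} (Γ : Subgroup (Isom n)) : Euc n → OrbitSpace Γ := Quotient.mk _

/-- A Bieberbach group: a discrete, cocompact, torsion-free subgroup of `I(ℝⁿ)`. Discreteness is
with respect to the topology of pointwise convergence, which is the usual topology of `I(ℝⁿ)`. -/
structure IsBieberbach {n : ℕ} (Γ : Subgroup (Isom n)) : Prop where
  discrete : DiscreteTopology ((fun (g : Isom n) (x : Euc n) => g x) '' (Γ : Set (Isom n)))
  cocompact : CompactSpace (OrbitSpace Γ)
  torsionFree : ∀ g ∈ Γ, IsOfFinOrder g → g = 1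

/-- The translation lattice `Λ` of `Γ`. -/
def translationLattice {n : ℕ} (Γ : Subgroup (Isom n)) : Set (Euc n) :=
  {b | translation b ∈ Γ}

/-- The point group `F ≅ Λ \ Γ` of `Γ`, i.e. the linear holonomy group of `M_Γ`. -/
def holonomyGroup {n : ℕ} (Γ : Subgroup (Isom n)) : Subgroup (Euc n ≃ₗᵢ[ℝ] Euc n) :=
  Γ.map (linearPart n)

/-! ### Differential forms on `M_Γ` and the Hodge-Laplacian -/

/-- `F`-valued `p`-forms on `ℝⁿ` (no smoothness is imposed here). -/
abbrev PForm (n p : ℕ) (F : Type) [NormedAddCommGroup F] [NormedSpace ℝ F] : Type :=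
  Euc n → Euc n [⋀^Fin p]→L[ℝ] F

/-- Smooth `p`-forms on `M_Γ`: smooth `p`-forms `α` on `ℝⁿ` with `γ^* α = α` for all `γ ∈ Γ`. -/
def IsSmoothForm {n p : ℕ} {F : Type} [NormedAddCommGroup F] [NormedSpace ℝ F]
    (Γ : Subgroup (Isom n)) (α : PForm n p F) : Prop :=
  ContDiff ℝ ∞ α ∧ ∀ g ∈ Γ, ∀ x : Euc n,
    (α (g x)).compContinuousLinearMap
      ((linearPart n g).toContinuousLinearEquiv : Euc n →L[ℝ] Euc n) = α x

/-- `M_Γ` is orientable: it carries a nowhere vanishing smooth real `n`-form. -/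
def IsOrientable {n : ℕ} (Γ : Subgroup (Isom n)) : Prop :=
  ∃ α : PForm n n ℝ, IsSmoothForm Γ α ∧ ∀ x, α x ≠ 0

/-- The codifferential of the Euclidean metric, `δα = - ∑ᵢ ι_{eᵢ} (∂ᵢ α)`. -/
def codiff {n p : ℕ} (α : PForm n (p + 1) ℂ) : PForm n p ℂ := fun x =>
  -∑ i : Fin n, (fderiv ℝ α x (EuclideanSpace.single i 1)).curryLeft (EuclideanSpace.single i 1)

/-- The (non-negative) Hodge-Laplacian `dδ + δd` on `p`-forms, with `δ = 0` on `0`-forms. -/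
def hodgeLaplacian {n : ℕ} : (p : ℕ) → PForm n p ℂ → PForm n p ℂ
  | 0, α => codiff (extDeriv α)
  | _ + 1, α => extDeriv (codiff α) + codiff (extDeriv α)

section linearity

variable {n p : ℕ}

theorem contDiff_extDeriv {α : PForm n p ℂ} (h : ContDiff ℝ ∞ α) :
    ContDiff ℝ ∞ (extDeriv α) := by
  have h1 : ContDiff ℝ ∞ (ContinuousAlternatingMap.alternatizeUncurryFinCLM ℝ (Euc n) ℂ (n := p)) :=
    ContinuousLinearMap.contDiff _
  exact h1.comp (h.fderiv_right (m := ∞) (by simp))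

/-- The contraction with a fixed vector, as a continuous linear map. -/
def contraction (n p : ℕ) (v : Euc n) :
    (Euc n [⋀^Fin (p + 1)]→L[ℝ] ℂ) →L[ℝ] (Euc n [⋀^Fin p]→L[ℝ] ℂ) :=
  (ContinuousLinearMap.apply ℝ _ v).comp
    (ContinuousAlternatingMap.curryLeftLI (𝕜 := ℝ) (E := Euc n) (F := ℂ) (n := p)).toContinuousLinearMap

theorem contDiff_codiff {α : PForm n (p + 1) ℂ} (h : ContDiff ℝ ∞ α) :
    ContDiff ℝ ∞ (codiff α) := by
  refine ContDiff.neg (ContDiff.sum fun i _ => ?_)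
  exact (contraction n p _).contDiff.comp
    ((h.fderiv_right (m := ∞) (by simp)).clm_apply contDiff_const)

theorem extDeriv_add' {α β : PForm n p ℂ} (hα : ContDiff ℝ ∞ α) (hβ : ContDiff ℝ ∞ β) :
    extDeriv (α + β) = extDeriv α + extDeriv β := by
  ext1 x
  exact _root_.extDeriv_add (hα.differentiable (by simp) x) (hβ.differentiable (by simp) x)

theorem codiff_add {α β : PForm n (p + 1) ℂ} (hα : ContDiff ℝ ∞ α) (hβ : ContDiff ℝ ∞ β) :
    codiff (α + β) = codiff α + codiff β := by
  ext1 x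
  simp only [codiff, Pi.add_apply]
  rw [fderiv_add (hα.differentiable (by simp) x) (hβ.differentiable (by simp) x),
    ← neg_add, ← Finset.sum_add_distrib]
  rfl

theorem extDeriv_smul' (c : ℂ) (α : PForm n p ℂ) (h : ContDiff ℝ ∞ α) :
    extDeriv (c • α) = c • extDeriv α := by
  funext x
  ext v
  have h' := h.differentiable (by simp) x
  rw [extDeriv, fderiv_const_smul h', Pi.smul_apply]
  simp [extDeriv, ContinuousAlternatingMap.alternatizeUncurryFin_apply, Finset.mul_sum]

theorem codiff_smul (c : ℂ) (α : PForm n (p + 1) ℂ) (h : ContDiff ℝ ∞ α) :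
    codiff (c • α) = c • codiff α := by
  funext x
  have h' := h.differentiable (by simp) x
  simp only [codiff, Pi.smul_apply]
  rw [fderiv_const_smul h', smul_neg, Finset.smul_sum]
  rfl

theorem hodgeLaplacian_add {α β : PForm n p ℂ} (hα : ContDiff ℝ ∞ α) (hβ : ContDiff ℝ ∞ β) :
    hodgeLaplacian p (α + β) = hodgeLaplacian p α + hodgeLaplacian p β := by
  cases p with
  | zero =>
    simp only [hodgeLaplacian]
    rw [extDeriv_add' hα hβ, codiff_add (contDiff_extDeriv hα) (contDiff_extDeriv hβ)]
  | succ p =>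
    simp only [hodgeLaplacian]
    rw [extDeriv_add' hα hβ, codiff_add (contDiff_extDeriv hα) (contDiff_extDeriv hβ),
      codiff_add hα hβ, extDeriv_add' (contDiff_codiff hα) (contDiff_codiff hβ)]
    abel

theorem hodgeLaplacian_smul (c : ℂ) {α : PForm n p ℂ} (hα : ContDiff ℝ ∞ α) :
    hodgeLaplacian p (c • α) = c • hodgeLaplacian p α := by
  cases p with
  | zero =>
    simp only [hodgeLaplacian]
    rw [extDeriv_smul' c α hα, codiff_smul c _ (contDiff_extDeriv hα)]
  | succ p =>
    simp only [hodgeLaplacian]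
    rw [extDeriv_smul' c α hα, codiff_smul c _ (contDiff_extDeriv hα),
      codiff_smul c _ hα, extDeriv_smul' c _ (contDiff_codiff hα), smul_add]

end linearity

/-- The space of smooth complex `p`-forms `α` on `M_Γ` with `(dδ + δd) α = lam • α`. -/
def eigenforms {n : ℕ} (Γ : Subgroup (Isom n)) (p : ℕ) (lam : ℝ) : Submodule ℂ (PForm n p ℂ) where
  carrier := {α | IsSmoothForm Γ α ∧ hodgeLaplacian p α = (lam : ℂ) • α}
  zero_mem' := by
    refine ⟨⟨contDiff_const, fun g _ x => rfl⟩, ?_⟩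
    have h := hodgeLaplacian_smul (n := n) (p := p) 0 (α := 0) contDiff_const
    simpa using h
  add_mem' := by
    rintro α β ⟨⟨h1, h2⟩, h3⟩ ⟨⟨k1, k2⟩, k3⟩
    refine ⟨⟨h1.add k1, fun g hg x => ?_⟩, ?_⟩
    · rw [Pi.add_apply, Pi.add_apply, ← h2 g hg x, ← k2 g hg x]; rfl
    · rw [hodgeLaplacian_add h1 k1, h3, k3, smul_add]
  smul_mem' := by
    rintro c α ⟨⟨h1, h2⟩, h3⟩
    refine ⟨⟨h1.const_smul c, fun g hg x => ?_⟩, ?_⟩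
    · rw [Pi.smul_apply, Pi.smul_apply, ← h2 g hg x]; rfl
    · rw [hodgeLaplacian_smul c h1, h3, smul_comm]

/-- `M_Γ` and `M_Γ'` are `p`-isospectral: every real number has the same multiplicity (dimension
of the eigenspace, zero if it is not an eigenvalue) for the two Hodge-Laplacians on `p`-forms. -/
def IsIsospectral {n : ℕ} (p : ℕ) (Γ Γ' : Subgroup (Isom n)) : Prop :=
  ∀ lam : ℝ, Module.rank ℂ (eigenforms Γ p lam) = Module.rank ℂ (eigenforms Γ' p lam)

/-! ### The exponential sums `e_{μ,B}(Γ)` -/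

/-- The dual lattice `{v | ⟨v, b⟩ ∈ ℤ for all b ∈ Λ}` of the translation lattice `Λ` of `Γ`. -/
def dualLattice {n : ℕ} (Γ : Subgroup (Isom n)) : Set (Euc n) :=
  {v | ∀ b ∈ translationLattice Γ, ∃ m : ℤ, inner ℝ v b = m}

/-- For `B` in the holonomy group, some `b` with `B L_b ∈ Γ`. It is unique modulo the translation
lattice. -/
def translationPart {n : ℕ} (Γ : Subgroup (Isom n)) (B : Euc n ≃ₗᵢ[ℝ] Euc n) : Euc n :=
  Classical.epsilon fun b => motion B b ∈ Γ

/-- `e_{μ,B}(Γ) = ∑ exp (2πi ⟨v, b⟩)`, where `B L_b ∈ Γ` and the sum runs over all `v` in the dual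
lattice with `‖v‖² = μ` and `B v = v`. -/
def expSum {n : ℕ} (Γ : Subgroup (Isom n)) (μ : ℝ) (B : Euc n ≃ₗᵢ[ℝ] Euc n) : ℂ :=
  ∑ᶠ v ∈ {v : Euc n | v ∈ dualLattice Γ ∧ ‖v‖ ^ 2 = μ ∧ B v = v},
    Complex.exp (2 * Real.pi * Complex.I * (inner ℝ v (translationPart Γ B) : ℝ))

/-! ### The two groups -/

/-- The canonical lattice `ℤⁿ`. -/
def canonicalLattice (n : ℕ) : Set (Euc n) := {x | ∀ i, ∃ m : ℤ, x i = m}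

/-- `B₁ = diag(J, J, I₂)` with `J = [0 1; -1 0]`. -/
def matB₁ : Matrix.orthogonalGroup (Fin 6) ℝ :=
  ⟨!![0, 1, 0, 0, 0, 0;
     -1, 0, 0, 0, 0, 0;
      0, 0, 0, 1, 0, 0;
      0, 0, -1, 0, 0, 0;
      0, 0, 0, 0, 1, 0;
      0, 0, 0, 0, 0, 1], by
    rw [Matrix.mem_orthogonalGroup_iff]
    ext i j
    fin_cases i <;> fin_cases j <;> simp [Matrix.mul_apply, Fin.sum_univ_succ]⟩

/-- `B₂ = diag(-I₂, I₂, I₂)`. -/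
def matB₂ : Matrix.orthogonalGroup (Fin 6) ℝ :=
  ⟨Matrix.diagonal ![-1, -1, 1, 1, 1, 1], by
    rw [Matrix.mem_orthogonalGroup_iff]
    ext i j
    fin_cases i <;> fin_cases j <;> simp [Matrix.mul_apply, Fin.sum_univ_succ]⟩

/-- `B₁' = diag(J, 1, -1, -1, 1)`. -/
def matB₁' : Matrix.orthogonalGroup (Fin 6) ℝ :=
  ⟨!![0, 1, 0, 0, 0, 0;
     -1, 0, 0, 0, 0, 0;
      0, 0, 1, 0, 0, 0;
      0, 0, 0, -1, 0, 0;
      0, 0, 0, 0, -1, 0;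
      0, 0, 0, 0, 0, 1], by
    rw [Matrix.mem_orthogonalGroup_iff]
    ext i j
    fin_cases i <;> fin_cases j <;> simp [Matrix.mul_apply, Fin.sum_univ_succ]⟩

/-- `B₂' = diag(-I₂, -1, 1, -1, 1)`. -/
def matB₂' : Matrix.orthogonalGroup (Fin 6) ℝ :=
  ⟨Matrix.diagonal ![-1, -1, -1, 1, -1, 1], by
    rw [Matrix.mem_orthogonalGroup_iff]
    ext i j
    fin_cases i <;> fin_cases j <;> simp [Matrix.mul_apply, Fin.sum_univ_succ]⟩

/-- The linear isometries of `ℝ⁶` given by these matrices. -/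
def isoB₁ : Euc 6 ≃ₗᵢ[ℝ] Euc 6 := orthogonalIsometry matB₁
def isoB₂ : Euc 6 ≃ₗᵢ[ℝ] Euc 6 := orthogonalIsometry matB₂
def isoB₁' : Euc 6 ≃ₗᵢ[ℝ] Euc 6 := orthogonalIsometry matB₁'
def isoB₂' : Euc 6 ≃ₗᵢ[ℝ] Euc 6 := orthogonalIsometry matB₂'

/-- `Γ = ⟨B₁ L_{e₅/4}, B₂ L_{e₆/2}, L_λ : λ ∈ ℤ⁶⟩`. -/
def groupΓ : Subgroup (Isom 6) :=
  Subgroup.closure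
    ({motion isoB₁ !₂[0, 0, 0, 0, 1 / 4, 0], motion isoB₂ !₂[0, 0, 0, 0, 0, 1 / 2]} ∪
      translation '' canonicalLattice 6)

/-- `Γ' = ⟨B₁' L_{e₆/4}, B₂' L_{(e₄+e₅)/2}, L_λ : λ ∈ ℤ⁶⟩`. -/
def groupΓ' : Subgroup (Isom 6) :=
  Subgroup.closure
    ({motion isoB₁' !₂[0, 0, 0, 0, 0, 1 / 4], motion isoB₂' !₂[0, 0, 0, 1 / 2, 1 / 2, 0]} ∪
      translation '' canonicalLattice 6)

end

/-!
Both groups are extensions of `ℤ₄ × ℤ₂` by `ℤ⁶`, generated by `ℤ⁶` and two motions, so that every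
element has a unique normal form `B₁ⁱ B₂ʲ L_b` with `b ≡ i b₁ + j b₂` modulo the lattice
(`PairData.exists_of_mem_group`, `PairData.motion_mem_group`). Translation lattice, holonomy and
translation parts are read off from it. The action is free because for each nontrivial rotation
there is a lattice vector `v` fixed by it with `⟨v, b⟩ ∉ ℤ`, so that the motion moves all points
by the same nonzero amount along `v`; this also excludes torsion. The quotient map is then a
covering, and the fundamental group is the group itself. The groups are not isomorphic because the
centre of `Γ` contains two independent translations, along `e₅` and `e₆`, whereas every central
element of `Γ'` is a translation along `e₆`.

On flat space the Hodge-Laplacian is `-∑ᵢ ∂ᵢ²` acting on coefficients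
(`hodgeLaplacian_eq_laplacian`). Fourier analysis on the torus shows that a lattice-periodic smooth
eigenfunction with eigenvalue `λ` is a finite combination of the characters `e^{2πi⟨v, x⟩}` with
`4π²‖v‖² = λ` (`exists_eq_sum_expChar`). If the bundle of `p`-forms is spanned by an invariant form,
as for `p = 0` and `p = 6`, the eigenforms on the quotient are the combinations invariant under
the holonomy group, which acts on the characters by a monomial representation; the dimension of
the invariants is the average of its traces, and these are the sums `e_{μ,B}`
(`PairData.eight_mul_finrank_invariants`). A permutation of the coordinates matches `e_{μ,B}(Γ)`
with `e_{μ,Φ(B)}(Γ')` for each `B` (`expSum_rot_eq`), which gives isospectrality in degrees `0`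
and `6`.

For `1 ≤ p ≤ 5` the eigenvalue `0` has different multiplicities: harmonic forms have constant
coefficients, so they are the holonomy-invariant alternating forms, and the Betti numbers are
`2, 3, 4, 3, 2` for `Γ` and `1, 1, 2, 1, 1` for `Γ'`. It is enough to bound the first ones from
below and the second ones from above (`not_isIsospectral_groupΓ_groupΓ'`).
-/

noncomputable section

/-! ### Groups generated by a lattice and two commuting rotations -/

/-- The canonical lattice `ℤⁿ` as an additive subgroup. -/
def latticeSubgroup (n : ℕ) : AddSubgroup (Euc n) where
  carrier := canonicalLattice n
  zero_mem' := fun i => ⟨0, by simp⟩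
  add_mem' := by
    intro a b ha hb i
    obtain ⟨k, hk⟩ := ha i
    obtain ⟨l, hl⟩ := hb i
    exact ⟨k + l, by simp [hk, hl]⟩
  neg_mem' := by
    intro a ha i
    obtain ⟨k, hk⟩ := ha i
    exact ⟨-k, by simp [hk]⟩

theorem mem_latticeSubgroup {n : ℕ} {x : Euc n} :
    x ∈ latticeSubgroup n ↔ ∀ i, ∃ m : ℤ, x i = m := Iff.rfl

theorem exists_inner_eq_intCast {n : ℕ} {x y : Euc n} (hx : x ∈ latticeSubgroup n)
    (hy : y ∈ latticeSubgroup n) : ∃ m : ℤ, inner ℝ x y = m := by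
  choose k hk using hx
  choose l hl using hy
  refine ⟨∑ i, k i * l i, ?_⟩
  rw [PiLp.inner_apply]
  push_cast
  refine Finset.sum_congr rfl fun i _ => ?_
  rw [hk, hl]
  simp [mul_comm]

theorem single_mem_latticeSubgroup {n : ℕ} (i : Fin n) (m : ℤ) :
    EuclideanSpace.single i (m : ℝ) ∈ latticeSubgroup n := by
  intro j
  by_cases h : j = i
  · exact ⟨m, by simp [h]⟩
  · exact ⟨0, by simp [h]⟩

theorem motion_mul {n : ℕ} (A B : Euc n ≃ₗᵢ[ℝ] Euc n) (a b : Euc n) :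
    motion A a * motion B b = motion (A * B) (B⁻¹ a + b) := by
  ext1 x
  have h : B (B⁻¹ a) = a := B.apply_symm_apply a
  rw [motion_apply]
  change motion A a (motion B b x) = A (B _)
  rw [motion_apply, motion_apply, map_add B, map_add B, map_add B, h]
  congr 1
  abel

theorem motion_one {n : ℕ} (b : Euc n) : motion 1 b = translation b := by
  ext1 x
  rw [motion_apply, add_comm]
  rfl

theorem translation_apply {n : ℕ} (b x : Euc n) : translation b x = b + x := rfl

theorem linearPart_motion {n : ℕ} (B : Euc n ≃ₗᵢ[ℝ] Euc n) (b : Euc n) :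
    linearPart n (motion B b) = B := by
  ext1 x
  have h : (linearPart n (motion B b)) x = motion B b x - motion B b 0 := by
    have := (motion B b).map_vadd 0 x
    simp only [vadd_eq_add, add_zero] at this
    rw [this, add_sub_cancel_right]
    rfl
  rw [h, motion_apply, motion_apply, ← map_sub]
  simp

theorem motion_inj {n : ℕ} {A B : Euc n ≃ₗᵢ[ℝ] Euc n} {a b : Euc n} :
    motion A a = motion B b ↔ A = B ∧ a = b := by
  refine ⟨fun h => ?_, fun h => by rw [h.1, h.2]⟩
  have h1 : A = B := by rw [← linearPart_motion A a, h, linearPart_motion]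
  refine ⟨h1, ?_⟩
  have h2 := DFunLike.congr_fun h 0
  rw [motion_apply, motion_apply, h1] at h2
  simpa using B.injective h2

/-- Two motions `B₁ L_{b₁}`, `B₂ L_{b₂}` of `ℝⁿ` which normalise `ℤⁿ` and whose classes modulo
`ℤⁿ` commute and generate a group `ℤ₄ × ℤ₂`. The field `free` gives, for
each non-trivial `B = B₁ⁱ B₂ʲ`, a lattice vector `v` fixed by `B` along which the corresponding
motion translates by a non-integer; this forces the group to act freely. -/
structure PairData (n : ℕ) where
  B₁ : Euc n ≃ₗᵢ[ℝ] Euc n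
  B₂ : Euc n ≃ₗᵢ[ℝ] Euc n
  b₁ : Euc n
  b₂ : Euc n
  comm : B₁ * B₂ = B₂ * B₁
  pow₁ : B₁ ^ 4 = 1
  pow₂ : B₂ ^ 2 = 1
  map₁ : ∀ x ∈ latticeSubgroup n, B₁ x ∈ latticeSubgroup n
  map₂ : ∀ x ∈ latticeSubgroup n, B₂ x ∈ latticeSubgroup n
  sub₁₁ : B₁ b₁ - b₁ ∈ latticeSubgroup n
  sub₁₂ : B₁ b₂ - b₂ ∈ latticeSubgroup n
  sub₂₁ : B₂ b₁ - b₁ ∈ latticeSubgroup n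
  sub₂₂ : B₂ b₂ - b₂ ∈ latticeSubgroup n
  four_smul : 4 • b₁ ∈ latticeSubgroup n
  two_smul : 2 • b₂ ∈ latticeSubgroup n
  free : ∀ i < 4, ∀ j < 2, (i ≠ 0 ∨ j ≠ 0) → ∃ v ∈ latticeSubgroup n,
    (B₁ ^ i * B₂ ^ j) v = v ∧ ∀ m : ℤ, inner ℝ v (i • b₁ + j • b₂) ≠ m
  indep : ∀ i < 4, ∀ j < 2, B₁ ^ i * B₂ ^ j = 1 → i = 0 ∧ j = 0

namespace PairData

variable {n : ℕ} (D : PairData n)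

/-- The group generated by the two motions and the lattice translations. -/
def group : Subgroup (Isom n) :=
  Subgroup.closure ({motion D.B₁ D.b₁, motion D.B₂ D.b₂} ∪ translation '' canonicalLattice n)

/-- The rotation `B₁ⁱ B₂ʲ`. -/
def rot (i j : ℕ) : Euc n ≃ₗᵢ[ℝ] Euc n := D.B₁ ^ i * D.B₂ ^ j

/-- The translation vector `i b₁ + j b₂` that belongs to `B₁ⁱ B₂ʲ`. -/
def shift (i j : ℕ) : Euc n := i • D.b₁ + j • D.b₂

theorem rot_mul (i j k l : ℕ) : D.rot i j * D.rot k l = D.rot (i + k) (j + l) := by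
  have h : Commute (D.B₂ ^ j) (D.B₁ ^ k) := (Commute.pow_pow D.comm _ _).symm
  simp only [rot, pow_add]
  rw [mul_assoc, ← mul_assoc (D.B₂ ^ j), h.eq]
  simp only [mul_assoc]

theorem rot_zero : D.rot 0 0 = 1 := by simp [rot]

theorem shift_zero : D.shift 0 0 = 0 := by simp [shift]

theorem shift_add (i j k l : ℕ) : D.shift i j + D.shift k l = D.shift (i + k) (j + l) := by
  simp only [shift, add_smul]
  abel

theorem rot_mod (i j : ℕ) : D.rot i j = D.rot (i % 4) (j % 2) := by
  rw [rot, rot, pow_eq_pow_mod i D.pow₁, pow_eq_pow_mod j D.pow₂]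

theorem rot_inv (i j : ℕ) : (D.rot i j)⁻¹ = D.rot (3 * i) j := by
  rw [inv_eq_iff_mul_eq_one, rot_mul, rot_mod, show (i + 3 * i) % 4 = 0 by omega,
    show (j + j) % 2 = 0 by omega, rot_zero]

theorem shift_sub_mod_mem (i j : ℕ) :
    D.shift i j - D.shift (i % 4) (j % 2) ∈ latticeSubgroup n := by
  have h : D.shift i j - D.shift (i % 4) (j % 2) = (i / 4) • (4 • D.b₁) + (j / 2) • (2 • D.b₂) := by
    have h1 : i • D.b₁ = (i % 4) • D.b₁ + (i / 4) • (4 • D.b₁) := by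
      rw [smul_smul, ← add_smul]; congr 1; omega
    have h2 : j • D.b₂ = (j % 2) • D.b₂ + (j / 2) • (2 • D.b₂) := by
      rw [smul_smul, ← add_smul]; congr 1; omega
    rw [shift, h1, h2, shift]
    abel
  rw [h]
  exact add_mem (nsmul_mem D.four_smul _) (nsmul_mem D.two_smul _)

theorem rot_one_zero : D.rot 1 0 = D.B₁ := by simp [rot]

theorem rot_zero_one : D.rot 0 1 = D.B₂ := by simp [rot]

/-- The isometries `B` with `B ℤⁿ ⊆ ℤⁿ` that fix `b₁` and `b₂` modulo `ℤⁿ`. -/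
def stable : Submonoid (Euc n ≃ₗᵢ[ℝ] Euc n) where
  carrier := {B | (∀ x ∈ latticeSubgroup n, B x ∈ latticeSubgroup n) ∧
    B D.b₁ - D.b₁ ∈ latticeSubgroup n ∧ B D.b₂ - D.b₂ ∈ latticeSubgroup n}
  one_mem' := ⟨fun x hx => hx, by simp, by simp⟩
  mul_mem' := by
    rintro A B ⟨h1, h2, h3⟩ ⟨k1, k2, k3⟩
    refine ⟨fun x hx => h1 _ (k1 x hx), ?_, ?_⟩
    · have := add_mem (h1 _ k2) h2
      rwa [map_sub, sub_add_sub_cancel] at this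
    · have := add_mem (h1 _ k3) h3
      rwa [map_sub, sub_add_sub_cancel] at this

theorem rot_mem_stable (i j : ℕ) : D.rot i j ∈ D.stable :=
  mul_mem (pow_mem (show D.B₁ ∈ D.stable from ⟨D.map₁, D.sub₁₁, D.sub₁₂⟩) i)
    (pow_mem (show D.B₂ ∈ D.stable from ⟨D.map₂, D.sub₂₁, D.sub₂₂⟩) j)

theorem rot_apply_mem (i j : ℕ) {x : Euc n} (hx : x ∈ latticeSubgroup n) :
    D.rot i j x ∈ latticeSubgroup n := (D.rot_mem_stable i j).1 x hx

theorem rot_shift_sub_mem (i j k l : ℕ) :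
    D.rot i j (D.shift k l) - D.shift k l ∈ latticeSubgroup n := by
  have h : D.rot i j (D.shift k l) - D.shift k l =
      k • (D.rot i j D.b₁ - D.b₁) + l • (D.rot i j D.b₂ - D.b₂) := by
    simp only [shift, map_add, map_nsmul, smul_sub]
    abel
  rw [h]
  exact add_mem (nsmul_mem (D.rot_mem_stable i j).2.1 _) (nsmul_mem (D.rot_mem_stable i j).2.2 _)

theorem translation_mem_group {v : Euc n} (hv : v ∈ latticeSubgroup n) :
    translation v ∈ D.group :=
  Subgroup.subset_closure (Or.inr ⟨v, hv, rfl⟩)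

theorem motion_one_zero_mem_group : motion D.B₁ D.b₁ ∈ D.group :=
  Subgroup.subset_closure (Or.inl (Or.inl rfl))

theorem motion_zero_one_mem_group : motion D.B₂ D.b₂ ∈ D.group :=
  Subgroup.subset_closure (Or.inl (Or.inr rfl))

theorem motion_mul_rot (i j k l : ℕ) {v w : Euc n} (hv : v ∈ latticeSubgroup n)
    (hw : w ∈ latticeSubgroup n) : ∃ u ∈ latticeSubgroup n,
    motion (D.rot i j) (D.shift i j + v) * motion (D.rot k l) (D.shift k l + w) =
      motion (D.rot (i + k) (j + l)) (D.shift (i + k) (j + l) + u) := by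
  refine ⟨D.rot (3 * k) l (D.shift i j) - D.shift i j + D.rot (3 * k) l v + w,
    add_mem (add_mem (D.rot_shift_sub_mem _ _ _ _) (D.rot_apply_mem _ _ hv)) hw, ?_⟩
  rw [motion_mul, rot_mul, rot_inv, ← shift_add, map_add]
  congr 1
  abel

theorem motion_rot_mod (i j : ℕ) {v : Euc n} (hv : v ∈ latticeSubgroup n) :
    ∃ u ∈ latticeSubgroup n, motion (D.rot i j) (D.shift i j + v) =
      motion (D.rot (i % 4) (j % 2)) (D.shift (i % 4) (j % 2) + u) := by
  refine ⟨_, add_mem (D.shift_sub_mod_mem i j) hv, ?_⟩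
  rw [← D.rot_mod i j]
  congr 1
  abel

/-- Every element of the group has the form `B₁ⁱ B₂ʲ L_{i b₁ + j b₂ + v}` with a lattice
vector `v`. -/
theorem exists_of_mem_group {g : Isom n} (hg : g ∈ D.group) : ∃ i < 4, ∃ j < 2,
    ∃ v ∈ latticeSubgroup n, g = motion (D.rot i j) (D.shift i j + v) := by
  suffices h : ∃ i j : ℕ, ∃ v ∈ latticeSubgroup n,
      g = motion (D.rot i j) (D.shift i j + v) by
    obtain ⟨i, j, v, hv, rfl⟩ := h
    obtain ⟨u, hu, h⟩ := D.motion_rot_mod i j hv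
    exact ⟨i % 4, Nat.mod_lt _ (by norm_num), j % 2, Nat.mod_lt _ (by norm_num), u, hu, h⟩
  induction hg using Subgroup.closure_induction with
  | mem x hx =>
    rcases hx with (rfl | rfl) | ⟨v, hv, rfl⟩
    · exact ⟨1, 0, 0, zero_mem _, by simp [rot, shift]⟩
    · exact ⟨0, 1, 0, zero_mem _, by simp [rot, shift]⟩
    · exact ⟨0, 0, v, hv, by rw [rot_zero, shift_zero, zero_add, motion_one]⟩
  | one =>
    refine ⟨0, 0, 0, zero_mem _, ?_⟩
    rw [rot_zero, shift_zero, zero_add, motion_one]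
    ext1 x
    simp [translation_apply]
  | mul x y _ _ hx hy =>
    obtain ⟨i, j, v, hv, rfl⟩ := hx
    obtain ⟨k, l, w, hw, rfl⟩ := hy
    obtain ⟨u, hu, h⟩ := D.motion_mul_rot i j k l hv hw
    exact ⟨_, _, u, hu, h⟩
  | inv x _ hx =>
    obtain ⟨i, j, v, hv, rfl⟩ := hx
    obtain ⟨u, hu, h⟩ := D.motion_mul_rot i j (3 * i) j hv (zero_mem _)
    obtain ⟨u', hu', h'⟩ := D.motion_rot_mod (i + 3 * i) (j + j) hu
    refine ⟨3 * i, j, -u', neg_mem hu', ?_⟩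
    rw [inv_eq_iff_mul_eq_one]
    have h4 : (i + 3 * i) % 4 = 0 := by omega
    have h2 : (j + j) % 2 = 0 := by omega
    rw [h', h4, h2, rot_zero, shift_zero, zero_add, motion_one, add_zero] at h
    have hs : motion (D.rot (3 * i) j) (D.shift (3 * i) j + -u') =
        motion (D.rot (3 * i) j) (D.shift (3 * i) j) * translation (-u') := by
      rw [← motion_one, motion_mul, inv_one, mul_one]
      rfl
    rw [hs, ← mul_assoc, h]
    ext1 x
    change u' + (-u' + x) = x
    abel

/-- All motions of the normal form belong to the group. -/
theorem motion_mem_group (i j : ℕ) {v : Euc n} (hv : v ∈ latticeSubgroup n) :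
    motion (D.rot i j) (D.shift i j + v) ∈ D.group := by
  have h1 : ∀ i, ∃ u ∈ latticeSubgroup n, motion (D.rot i 0) (D.shift i 0 + u) ∈ D.group := by
    intro i
    induction i with
    | zero =>
      exact ⟨0, zero_mem _, by
        rw [rot_zero, shift_zero, add_zero, motion_one]
        exact D.translation_mem_group (zero_mem _)⟩
    | succ i ih =>
      obtain ⟨u, hu, h⟩ := ih
      obtain ⟨w, hw, h'⟩ := D.motion_mul_rot i 0 1 0 hu (zero_mem _)
      refine ⟨w, hw, ?_⟩
      rw [← h']
      refine mul_mem h ?_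
      simpa [rot, shift] using D.motion_one_zero_mem_group
  have h2 : ∃ u ∈ latticeSubgroup n, motion (D.rot i j) (D.shift i j + u) ∈ D.group := by
    induction j with
    | zero => exact h1 i
    | succ j ih =>
      obtain ⟨u, hu, h⟩ := ih
      obtain ⟨w, hw, h'⟩ := D.motion_mul_rot i j 0 1 hu (zero_mem _)
      refine ⟨w, hw, ?_⟩
      change motion (D.rot (i + 0) (j + 1)) (D.shift (i + 0) (j + 1) + w) ∈ D.group
      rw [← h']
      refine mul_mem h ?_
      simpa [rot, shift] using D.motion_zero_one_mem_group
  obtain ⟨u, hu, h⟩ := h2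
  have := mul_mem h (D.translation_mem_group (sub_mem hv hu))
  rw [← motion_one, motion_mul, inv_one, mul_one] at this
  convert this using 2
  change _ = (D.shift i j + u) + (v - u)
  abel

theorem rot_inj {i j k l : ℕ} (hi : i < 4) (hj : j < 2) (hk : k < 4) (hl : l < 2)
    (h : D.rot i j = D.rot k l) : i = k ∧ j = l := by
  have h1 : D.rot (i + 3 * k) (j + l) = 1 := by
    rw [← rot_mul, ← rot_inv, h, mul_inv_cancel]
  rw [rot_mod] at h1
  have := D.indep _ (Nat.mod_lt _ (by norm_num)) _ (Nat.mod_lt _ (by norm_num)) h1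
  omega

theorem translationLattice_group : translationLattice D.group = canonicalLattice n := by
  ext b
  refine ⟨fun hb => ?_, fun hb => D.translation_mem_group hb⟩
  obtain ⟨i, hi, j, hj, v, hv, h⟩ := D.exists_of_mem_group hb
  rw [← motion_one, motion_inj] at h
  obtain ⟨rfl, rfl⟩ := D.indep i hi j hj h.1.symm
  rw [h.2, shift_zero, zero_add]
  exact hv

theorem mem_holonomyGroup {B : Euc n ≃ₗᵢ[ℝ] Euc n} :
    B ∈ holonomyGroup D.group ↔ ∃ i < 4, ∃ j < 2, B = D.rot i j := by
  constructor
  · rintro ⟨g, hg, rfl⟩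
    obtain ⟨i, hi, j, hj, v, hv, rfl⟩ := D.exists_of_mem_group hg
    exact ⟨i, hi, j, hj, linearPart_motion _ _⟩
  · rintro ⟨i, hi, j, hj, rfl⟩
    exact ⟨_, D.motion_mem_group i j (zero_mem _), linearPart_motion _ _⟩

/-- The isomorphism of `ℤ₄ × ℤ₂` onto the holonomy group, `(i, j) ↦ B₁ⁱ B₂ʲ`. -/
def holonomyEquiv : Multiplicative (ZMod 4 × ZMod 2) ≃* holonomyGroup D.group :=
  MulEquiv.ofBijective
    (MonoidHom.mk' (fun a => ⟨D.rot a.toAdd.1.val a.toAdd.2.val, D.mem_holonomyGroup.2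
        ⟨_, ZMod.val_lt _, _, ZMod.val_lt _, rfl⟩⟩) (by
      intro a b
      apply Subtype.ext
      change D.rot _ _ = D.rot _ _ * D.rot _ _
      rw [rot_mul, D.rot_mod (_ + _)]
      simp only [toAdd_mul, Prod.fst_add, Prod.snd_add, ZMod.val_add])) (by
    constructor
    · intro a b h
      obtain ⟨h1, h2⟩ := D.rot_inj (ZMod.val_lt _) (ZMod.val_lt _) (ZMod.val_lt _) (ZMod.val_lt _)
        (Subtype.ext_iff.1 h)
      exact Multiplicative.toAdd.injective
        (Prod.ext (ZMod.val_injective _ h1) (ZMod.val_injective _ h2))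
    · rintro ⟨B, hB⟩
      obtain ⟨i, hi, j, hj, rfl⟩ := D.mem_holonomyGroup.1 hB
      refine ⟨Multiplicative.ofAdd ((i : ZMod 4), (j : ZMod 2)), Subtype.ext ?_⟩
      change D.rot (i : ZMod 4).val (j : ZMod 2).val = D.rot i j
      rw [ZMod.val_natCast_of_lt hi, ZMod.val_natCast_of_lt hj])

theorem coe_holonomyEquiv (a : ZMod 4 × ZMod 2) :
    (D.holonomyEquiv (Multiplicative.ofAdd a) : Euc n ≃ₗᵢ[ℝ] Euc n) = D.rot a.1.val a.2.val := rfl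

theorem dualLattice_group : dualLattice D.group = canonicalLattice n := by
  ext v
  rw [dualLattice, translationLattice_group]
  refine ⟨fun h i => ?_, fun h b hb => exists_inner_eq_intCast h hb⟩
  obtain ⟨m, hm⟩ := h _ (single_mem_latticeSubgroup i 1)
  exact ⟨m, by simpa [EuclideanSpace.inner_single_right] using hm⟩

theorem translationPart_rot {i j : ℕ} (hi : i < 4) (hj : j < 2) :
    ∃ u ∈ latticeSubgroup n, translationPart D.group (D.rot i j) = D.shift i j + u := by
  have h : motion (D.rot i j) (translationPart D.group (D.rot i j)) ∈ D.group :=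
    Classical.epsilon_spec (p := fun b => motion (D.rot i j) b ∈ D.group)
      ⟨_, D.motion_mem_group i j (zero_mem _)⟩
  obtain ⟨k, hk, l, hl, v, hv, h⟩ := D.exists_of_mem_group h
  rw [motion_inj] at h
  obtain ⟨rfl, rfl⟩ := D.rot_inj hi hj hk hl h.1
  exact ⟨v, hv, h.2⟩

end PairData

/-! ### The action on `ℝⁿ` -/

theorem isom_mul_apply {n : ℕ} (g h : Isom n) (x : Euc n) : (g * h) x = g (h x) := rfl

theorem pow_apply_eq_self {n : ℕ} {B : Euc n ≃ₗᵢ[ℝ] Euc n} {v : Euc n} (h : B v = v) (k : ℕ) :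
    (B ^ k) v = v := by
  induction k with
  | zero => rfl
  | succ k ih => rw [pow_succ]; change (B ^ k) (B v) = v; rw [h, ih]

theorem finite_latticeSubgroup_norm_le (n : ℕ) (R : ℝ) :
    {v : Euc n | v ∈ latticeSubgroup n ∧ ‖v‖ ≤ R}.Finite := by
  have h : (Set.pi Set.univ fun _ : Fin n => Set.Icc (-⌈R⌉) ⌈R⌉).Finite :=
    Set.Finite.pi fun _ => Set.finite_Icc _ _
  refine (h.image fun k => (WithLp.toLp 2 fun i => (k i : ℝ) : Euc n)).subset ?_
  rintro v ⟨hv, hR⟩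
  choose k hk using hv
  refine ⟨k, fun i _ => ?_, ?_⟩
  · have h1 : |v i| ≤ R := (PiLp.norm_apply_le v i).trans hR
    rw [hk, abs_le] at h1
    have h2 := Int.le_ceil R
    constructor
    · have : (-⌈R⌉ : ℝ) ≤ k i := by linarith
      exact_mod_cast this
    · have : (k i : ℝ) ≤ ⌈R⌉ := by linarith
      exact_mod_cast this
  · ext i
    exact (hk i).symm

namespace PairData

variable {n : ℕ} (D : PairData n)

/-- A non-trivial element of the group moves all points by the same non-zero amount along a
suitable vector. -/
theorem exists_inner_apply_eq_add {g : Isom n} (hg : g ∈ D.group) (hg1 : g ≠ 1) :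
    ∃ (v : Euc n) (c : ℝ), c ≠ 0 ∧ ∀ x, inner ℝ v (g x) = inner ℝ v x + c := by
  obtain ⟨i, hi, j, hj, u, hu, rfl⟩ := D.exists_of_mem_group hg
  by_cases hij : i ≠ 0 ∨ j ≠ 0
  · obtain ⟨v, hv, hfix, hne⟩ := D.free i hi j hj hij
    refine ⟨v, inner ℝ v (D.shift i j + u), fun h0 => ?_, fun x => ?_⟩
    · obtain ⟨m, hm⟩ := exists_inner_eq_intCast hv hu
      rw [inner_add_right, hm] at h0
      refine hne (-m) ?_
      push_cast
      exact eq_neg_of_add_eq_zero_left h0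
    · have h1 : inner ℝ v (D.rot i j (x + (D.shift i j + u))) =
          inner ℝ (D.rot i j v) (D.rot i j (x + (D.shift i j + u))) := by
        rw [show D.rot i j v = v from hfix]
      rw [motion_apply, h1, LinearIsometryEquiv.inner_map_map, inner_add_right]
  · obtain ⟨rfl, rfl⟩ : i = 0 ∧ j = 0 := by omega
    rw [rot_zero, shift_zero, zero_add, motion_one] at hg1 ⊢
    have hu0 : u ≠ 0 := by
      rintro rfl
      exact hg1 (by ext1 x; simp [translation_apply])
    refine ⟨u, inner ℝ u u, by simpa using hu0, fun x => ?_⟩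
    rw [translation_apply, inner_add_right, add_comm]

/-- The group acts freely. -/
instance isCancelSMul : IsCancelSMul D.group (Euc n) := by
  rw [isCancelSMul_iff_eq_one_of_smul_eq]
  rintro ⟨g, hg⟩ x hx
  by_contra h
  obtain ⟨v, c, hc, hv⟩ := D.exists_inner_apply_eq_add hg (fun h' => h (Subtype.ext h'))
  have := hv x
  rw [show g x = x from hx] at this
  exact hc (by linarith)

theorem eq_one_of_isOfFinOrder {g : Isom n} (hg : g ∈ D.group) (hfin : IsOfFinOrder g) :
    g = 1 := by
  by_contra h
  obtain ⟨v, c, hc, hv⟩ := D.exists_inner_apply_eq_add hg h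
  obtain ⟨k, hk, hgk⟩ := isOfFinOrder_iff_pow_eq_one.1 hfin
  have h1 : ∀ k : ℕ, inner ℝ v ((g ^ k) 0) = k * c := by
    intro k
    induction k with
    | zero => simp
    | succ k ih =>
      rw [pow_succ']
      change inner ℝ v (g ((g ^ k) 0)) = _
      rw [hv, ih]
      push_cast
      ring
  have h2 := h1 k
  rw [hgk] at h2
  simp [hc, hk.ne'] at h2

instance continuousConstSMul : ContinuousConstSMul D.group (Euc n) :=
  ⟨fun g => (g : Isom n).continuous⟩

instance properlyDiscontinuousSMul : ProperlyDiscontinuousSMul D.group (Euc n) where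
  finite_disjoint_inter_image := by
    intro K L hK hL
    obtain ⟨R, hR⟩ := hK.isBounded.exists_norm_le
    obtain ⟨S, hS⟩ := hL.isBounded.exists_norm_le
    -- a motion `B L_{b + u}` that maps a point of `K` into `L` has `‖u‖ ≤ S + R + ‖b‖`
    let F : (ℕ × ℕ) → Set (Isom n) := fun ij =>
      (fun u => motion (D.rot ij.1 ij.2) (D.shift ij.1 ij.2 + u)) ''
        {u : Euc n | u ∈ latticeSubgroup n ∧ ‖u‖ ≤ S + R + ‖D.shift ij.1 ij.2‖}
    have hF : (⋃ ij ∈ (Set.Iio 4 ×ˢ Set.Iio 2 : Set (ℕ × ℕ)), F ij).Finite :=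
      ((Set.finite_Iio 4).prod (Set.finite_Iio 2)).biUnion fun ij _ =>
        (finite_latticeSubgroup_norm_le _ _).image _
    refine Set.Finite.of_finite_image (f := Subtype.val) (hF.subset ?_)
      Subtype.val_injective.injOn
    rintro _ ⟨⟨g, hg⟩, ⟨_, ⟨x, hx, rfl⟩, hy⟩, rfl⟩
    obtain ⟨i, hi, j, hj, u, hu, rfl⟩ := D.exists_of_mem_group hg
    refine Set.mem_biUnion (x := (i, j)) ⟨hi, hj⟩ ⟨u, ⟨hu, ?_⟩, rfl⟩
    have h1 := hS _ hy
    change ‖motion (D.rot i j) (D.shift i j + u) x‖ ≤ S at h1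
    rw [motion_apply, LinearIsometryEquiv.norm_map] at h1
    have h2 : u = (x + (D.shift i j + u)) - x - D.shift i j := by abel
    rw [h2]
    exact (norm_sub_le _ _).trans (add_le_add ((norm_sub_le _ _).trans
      (add_le_add h1 (hR x hx))) le_rfl)

theorem isQuotientCoveringMap_orbitProj : IsQuotientCoveringMap (orbitProj D.group) D.group :=
  isQuotientCoveringMap_quotientMk_of_properlyDiscontinuousSMul

theorem t2Space_orbitSpace : T2Space (OrbitSpace D.group) := inferInstance

theorem discreteTopology_group :
    DiscreteTopology ((fun (g : Isom n) (x : Euc n) => g x) '' (D.group : Set (Isom n))) := by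
  rw [discreteTopology_subtype_iff']
  rintro _ ⟨g, hg, rfl⟩
  obtain ⟨U, hU, hdis⟩ := D.isQuotientCoveringMap_orbitProj.disjoint 0
  -- the orbit of `0` is discrete and the action is free, so evaluation at `0` separates `g`
  refine ⟨{f | f 0 ∈ g '' interior U}, ?_, ?_⟩
  · exact (g.toHomeomorph.isOpenMap _ isOpen_interior).preimage (continuous_apply 0)
  · ext f
    constructor
    · rintro ⟨⟨y, hy, hyf⟩, h, hh, rfl⟩
      have h1 := hdis ⟨g⁻¹ * h, mul_mem (inv_mem hg) hh⟩ ⟨y, ⟨0, mem_of_mem_nhds hU, ?_⟩,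
        interior_subset hy⟩
      · rw [inv_mul_eq_one.1 (Subtype.ext_iff.1 h1)]
        rfl
      · change g.symm (h 0) = y
        change g y = h 0 at hyf
        rw [← hyf, AffineIsometryEquiv.symm_apply_apply]
    · rintro rfl
      exact ⟨⟨0, mem_interior_iff_mem_nhds.2 hU, rfl⟩, g, hg, rfl⟩

theorem compactSpace_orbitSpace : CompactSpace (OrbitSpace D.group) := by
  have hcont : Continuous (orbitProj D.group) := D.isQuotientCoveringMap_orbitProj.continuous
  have hK : IsCompact (WithLp.toLp 2 '' Set.pi Set.univ fun _ => Set.Icc 0 1 : Set (Euc n)) :=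
    (isCompact_univ_pi fun _ => isCompact_Icc).image (PiLp.continuous_toLp 2 _)
  refine ⟨?_⟩
  convert hK.image hcont
  symm
  rw [Set.eq_univ_iff_forall]
  intro q
  obtain ⟨x, rfl⟩ := D.isQuotientCoveringMap_orbitProj.surjective q
  refine ⟨WithLp.toLp 2 fun i => Int.fract (x i), ⟨_, fun i _ =>
    ⟨Int.fract_nonneg _, (Int.fract_lt_one _).le⟩, rfl⟩, ?_⟩
  have hu : (WithLp.toLp 2 fun i => (-⌊x i⌋ : ℝ) : Euc n) ∈ latticeSubgroup n :=
    fun i => ⟨-⌊x i⌋, by simp⟩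
  refine (D.isQuotientCoveringMap_orbitProj.apply_eq_iff_mem_orbit).2
    ⟨⟨_, D.translation_mem_group hu⟩, ?_⟩
  change translation _ x = _
  rw [translation_apply]
  ext i
  change -(⌊x i⌋ : ℝ) + x i = Int.fract (x i)
  rw [Int.fract]
  ring

theorem isBieberbach : IsBieberbach D.group :=
  ⟨D.discreteTopology_group, D.compactSpace_orbitSpace, fun _ => D.eq_one_of_isOfFinOrder⟩

/-- The fundamental group of the orbit space is the group itself, because `ℝⁿ` is simply
connected. -/
theorem nonempty_fundamentalGroup_mulEquiv (x : OrbitSpace D.group) :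
    Nonempty (FundamentalGroup (OrbitSpace D.group) x ≃* D.group) := by
  obtain ⟨e, he⟩ := D.isQuotientCoveringMap_orbitProj.surjective x
  exact ⟨(D.isQuotientCoveringMap_orbitProj.fundamentalGroupEquiv ⟨e, he⟩).trans
    (MulEquiv.inv' D.group).symm⟩

/-! ### Central elements -/

theorem translation_mul_comm_of_fixed {u : Euc n} (hB₁ : D.B₁ u = u) (hB₂ : D.B₂ u = u)
    {g : Isom n} (hg : g ∈ D.group) : translation u * g = g * translation u := by
  obtain ⟨i, hi, j, hj, w, hw, rfl⟩ := D.exists_of_mem_group hg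
  have hfix : D.rot i j u = u := by
    change (D.B₁ ^ i) ((D.B₂ ^ j) u) = u
    rw [pow_apply_eq_self hB₂, pow_apply_eq_self hB₁]
  ext1 x
  rw [isom_mul_apply, isom_mul_apply, translation_apply, translation_apply, motion_apply,
    motion_apply, add_assoc, map_add _ u, hfix]

/-- A central element is the translation by a lattice vector fixed by both rotations. -/
theorem exists_of_commute_all {g : Isom n} (hg : g ∈ D.group)
    (h : ∀ k ∈ D.group, k * g = g * k) :
    ∃ u ∈ latticeSubgroup n, g = translation u ∧ D.B₁ u = u ∧ D.B₂ u = u := by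
  obtain ⟨i, hi, j, hj, w, hw, rfl⟩ := D.exists_of_mem_group hg
  have hfix : ∀ v ∈ latticeSubgroup n, D.rot i j v = v := by
    intro v hv
    have := DFunLike.congr_fun (h _ (D.translation_mem_group hv)) 0
    rw [isom_mul_apply, isom_mul_apply, translation_apply, translation_apply, motion_apply,
      motion_apply, add_zero, map_add _ v, zero_add] at this
    exact (add_right_cancel this).symm
  have h1 : D.rot i j = 1 := by
    apply LinearIsometryEquiv.toLinearEquiv_injective
    apply LinearEquiv.toLinearMap_injective
    refine (EuclideanSpace.basisFun (Fin n) ℝ).toBasis.ext fun k => ?_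
    simpa using hfix _ (single_mem_latticeSubgroup k 1)
  obtain ⟨rfl, rfl⟩ := D.indep i hi j hj h1
  rw [rot_zero, shift_zero, zero_add, motion_one] at h ⊢
  refine ⟨w, hw, rfl, ?_, ?_⟩
  · have := DFunLike.congr_fun (h _ D.motion_one_zero_mem_group) 0
    rw [isom_mul_apply, isom_mul_apply, translation_apply, translation_apply, motion_apply,
      motion_apply, add_zero, map_add, zero_add] at this
    exact add_right_cancel this
  · have := DFunLike.congr_fun (h _ D.motion_zero_one_mem_group) 0
    rw [isom_mul_apply, isom_mul_apply, translation_apply, translation_apply, motion_apply,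
      motion_apply, add_zero, map_add, zero_add] at this
    exact add_right_cancel this

end PairData

/-! ### The two groups as instances of the construction -/

theorem isoB₁_apply (x : Euc 6) : isoB₁ x = !₂[x 1, -x 0, x 3, -x 2, x 4, x 5] := by
  rw [isoB₁, orthogonalIsometry_apply]
  ext i
  fin_cases i <;> simp [matB₁, Matrix.mulVec, dotProduct, Fin.sum_univ_succ]

theorem isoB₂_apply (x : Euc 6) : isoB₂ x = !₂[-x 0, -x 1, x 2, x 3, x 4, x 5] := by
  rw [isoB₂, orthogonalIsometry_apply]
  ext i
  fin_cases i <;> simp [matB₂, Matrix.mulVec, dotProduct, Matrix.diagonal]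

theorem isoB₁'_apply (x : Euc 6) : isoB₁' x = !₂[x 1, -x 0, x 2, -x 3, -x 4, x 5] := by
  rw [isoB₁', orthogonalIsometry_apply]
  ext i
  fin_cases i <;> simp [matB₁', Matrix.mulVec, dotProduct, Fin.sum_univ_succ]

theorem isoB₂'_apply (x : Euc 6) : isoB₂' x = !₂[-x 0, -x 1, -x 2, x 3, -x 4, x 5] := by
  rw [isoB₂', orthogonalIsometry_apply]
  ext i
  fin_cases i <;> simp [matB₂', Matrix.mulVec, dotProduct, Matrix.diagonal]

theorem mem_latticeSubgroup_six {x : Euc 6} : x ∈ latticeSubgroup 6 ↔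
    (∃ m : ℤ, x 0 = m) ∧ (∃ m : ℤ, x 1 = m) ∧ (∃ m : ℤ, x 2 = m) ∧ (∃ m : ℤ, x 3 = m) ∧
      (∃ m : ℤ, x 4 = m) ∧ (∃ m : ℤ, x 5 = m) := by
  rw [mem_latticeSubgroup]
  simp [Fin.forall_fin_succ]

theorem exists_neg_eq_intCast {a : ℝ} (h : ∃ m : ℤ, a = m) : ∃ m : ℤ, -a = m := by
  obtain ⟨m, rfl⟩ := h
  exact ⟨-m, by simp⟩

theorem isometry_ext_six {A B : Euc 6 ≃ₗᵢ[ℝ] Euc 6} (h : ∀ x i, A x i = B x i) : A = B := by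
  ext1 x
  ext i
  exact h x i

theorem div_four_ne_intCast {i : ℕ} (h0 : i ≠ 0) (h4 : i < 4) (m : ℤ) : (i : ℝ) * 4⁻¹ ≠ m := by
  intro h
  have h1 : (i : ℝ) = 4 * m := by linarith
  have h2 : (i : ℤ) = 4 * m := by exact_mod_cast h1
  omega

theorem half_ne_intCast (m : ℤ) : (2⁻¹ : ℝ) ≠ m := by
  intro h
  have h1 : (1 : ℝ) = 2 * m := by linarith
  have h2 : (1 : ℤ) = 2 * m := by exact_mod_cast h1
  omega

/-- The data defining `Γ`. -/
def dataΓ : PairData 6 where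
  B₁ := isoB₁
  B₂ := isoB₂
  b₁ := !₂[0, 0, 0, 0, 1 / 4, 0]
  b₂ := !₂[0, 0, 0, 0, 0, 1 / 2]
  comm := by
    refine isometry_ext_six fun x i => ?_
    fin_cases i <;> simp [isoB₁_apply, isoB₂_apply]
  pow₁ := by
    refine isometry_ext_six fun x i => ?_
    fin_cases i <;> simp [isoB₁_apply, pow_succ]
  pow₂ := by
    refine isometry_ext_six fun x i => ?_
    fin_cases i <;> simp [isoB₂_apply, pow_succ]
  map₁ x hx := by
    rw [mem_latticeSubgroup_six] at hx ⊢
    obtain ⟨h0, h1, h2, h3, h4, h5⟩ := hx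
    rw [isoB₁_apply]
    exact ⟨h1, exists_neg_eq_intCast h0, h3, exists_neg_eq_intCast h2, h4, h5⟩
  map₂ x hx := by
    rw [mem_latticeSubgroup_six] at hx ⊢
    obtain ⟨h0, h1, h2, h3, h4, h5⟩ := hx
    rw [isoB₂_apply]
    exact ⟨exists_neg_eq_intCast h0, exists_neg_eq_intCast h1, h2, h3, h4, h5⟩
  sub₁₁ := by
    convert zero_mem (latticeSubgroup 6)
    ext i
    fin_cases i <;> simp [isoB₁_apply]
  sub₁₂ := by
    convert zero_mem (latticeSubgroup 6)
    ext i
    fin_cases i <;> simp [isoB₁_apply]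
  sub₂₁ := by
    convert zero_mem (latticeSubgroup 6)
    ext i
    fin_cases i <;> simp [isoB₂_apply]
  sub₂₂ := by
    convert zero_mem (latticeSubgroup 6)
    ext i
    fin_cases i <;> simp [isoB₂_apply]
  four_smul := by
    convert single_mem_latticeSubgroup (n := 6) 4 1
    ext i
    fin_cases i <;> simp
  two_smul := by
    convert single_mem_latticeSubgroup (n := 6) 5 1
    ext i
    fin_cases i <;> simp
  free i hi j hj hij := by
    by_cases h0 : i = 0
    · obtain ⟨rfl, rfl⟩ : i = 0 ∧ j = 1 := ⟨h0, by omega⟩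
      refine ⟨EuclideanSpace.single 5 1, by exact_mod_cast single_mem_latticeSubgroup 5 1, ?_,
        fun m => ?_⟩
      · ext i
        fin_cases i <;> simp [isoB₂_apply]
      · simpa [EuclideanSpace.inner_single_left] using half_ne_intCast m
    · refine ⟨EuclideanSpace.single 4 1, by exact_mod_cast single_mem_latticeSubgroup 4 1, ?_,
        fun m => ?_⟩
      · have h1 : isoB₁ (EuclideanSpace.single 4 1) = EuclideanSpace.single 4 1 := by
          ext i
          fin_cases i <;> simp [isoB₁_apply]
        have h2 : isoB₂ (EuclideanSpace.single 4 1) = EuclideanSpace.single 4 1 := by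
          ext i
          fin_cases i <;> simp [isoB₂_apply]
        change (isoB₁ ^ i) ((isoB₂ ^ j) _) = _
        rw [pow_apply_eq_self h2, pow_apply_eq_self h1]
      · simpa [EuclideanSpace.inner_single_left] using div_four_ne_intCast h0 hi m
  indep i hi j hj h := by
    have h' := DFunLike.congr_fun h !₂[1, 2, 3, 4, 5, 6]
    have h0 := congrFun (congrArg WithLp.ofLp h') 0
    have h2 := congrFun (congrArg WithLp.ofLp h') 2
    interval_cases i <;> interval_cases j <;>
      simp [isoB₁_apply, isoB₂_apply, pow_succ] at h0 h2 ⊢ <;> linarith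

/-- The data defining `Γ'`. -/
def dataΓ' : PairData 6 where
  B₁ := isoB₁'
  B₂ := isoB₂'
  b₁ := !₂[0, 0, 0, 0, 0, 1 / 4]
  b₂ := !₂[0, 0, 0, 1 / 2, 1 / 2, 0]
  comm := by
    refine isometry_ext_six fun x i => ?_
    fin_cases i <;> simp [isoB₁'_apply, isoB₂'_apply]
  pow₁ := by
    refine isometry_ext_six fun x i => ?_
    fin_cases i <;> simp [isoB₁'_apply, pow_succ]
  pow₂ := by
    refine isometry_ext_six fun x i => ?_
    fin_cases i <;> simp [isoB₂'_apply, pow_succ]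
  map₁ x hx := by
    rw [mem_latticeSubgroup_six] at hx ⊢
    obtain ⟨h0, h1, h2, h3, h4, h5⟩ := hx
    rw [isoB₁'_apply]
    exact ⟨h1, exists_neg_eq_intCast h0, h2, exists_neg_eq_intCast h3, exists_neg_eq_intCast h4, h5⟩
  map₂ x hx := by
    rw [mem_latticeSubgroup_six] at hx ⊢
    obtain ⟨h0, h1, h2, h3, h4, h5⟩ := hx
    rw [isoB₂'_apply]
    exact ⟨exists_neg_eq_intCast h0, exists_neg_eq_intCast h1, exists_neg_eq_intCast h2, h3,
      exists_neg_eq_intCast h4, h5⟩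
  sub₁₁ := by
    convert zero_mem (latticeSubgroup 6)
    ext i
    fin_cases i <;> simp [isoB₁'_apply]
  sub₁₂ := by
    convert add_mem (single_mem_latticeSubgroup (n := 6) 3 (-1)) (single_mem_latticeSubgroup 4 (-1))
    ext i
    fin_cases i <;> simp [isoB₁'_apply] <;> norm_num
  sub₂₁ := by
    convert zero_mem (latticeSubgroup 6)
    ext i
    fin_cases i <;> simp [isoB₂'_apply]
  sub₂₂ := by
    convert single_mem_latticeSubgroup (n := 6) 4 (-1)
    ext i
    (fin_cases i <;> simp [isoB₂'_apply])
    norm_num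
  four_smul := by
    convert single_mem_latticeSubgroup (n := 6) 5 1
    ext i
    fin_cases i <;> simp
  two_smul := by
    convert add_mem (single_mem_latticeSubgroup (n := 6) 3 1) (single_mem_latticeSubgroup 4 1)
    ext i
    fin_cases i <;> simp
  free i hi j hj hij := by
    by_cases h0 : i = 0
    · obtain ⟨rfl, rfl⟩ : i = 0 ∧ j = 1 := ⟨h0, by omega⟩
      refine ⟨EuclideanSpace.single 3 1, by exact_mod_cast single_mem_latticeSubgroup 3 1, ?_,
        fun m => ?_⟩
      · ext i
        fin_cases i <;> simp [isoB₂'_apply]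
      · simpa [EuclideanSpace.inner_single_left] using half_ne_intCast m
    · refine ⟨EuclideanSpace.single 5 1, by exact_mod_cast single_mem_latticeSubgroup 5 1, ?_,
        fun m => ?_⟩
      · have h1 : isoB₁' (EuclideanSpace.single 5 1) = EuclideanSpace.single 5 1 := by
          ext i
          fin_cases i <;> simp [isoB₁'_apply]
        have h2 : isoB₂' (EuclideanSpace.single 5 1) = EuclideanSpace.single 5 1 := by
          ext i
          fin_cases i <;> simp [isoB₂'_apply]
        change (isoB₁' ^ i) ((isoB₂' ^ j) _) = _
        rw [pow_apply_eq_self h2, pow_apply_eq_self h1]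
      · simpa [EuclideanSpace.inner_single_left] using div_four_ne_intCast h0 hi m
  indep i hi j hj h := by
    have h' := DFunLike.congr_fun h !₂[1, 2, 3, 4, 5, 6]
    have h0 := congrFun (congrArg WithLp.ofLp h') 0
    have h2 := congrFun (congrArg WithLp.ofLp h') 2
    interval_cases i <;> interval_cases j <;>
      simp [isoB₁'_apply, isoB₂'_apply, pow_succ] at h0 h2 ⊢ <;> linarith

theorem dataΓ_B₁ : dataΓ.B₁ = isoB₁ := rfl
theorem dataΓ_B₂ : dataΓ.B₂ = isoB₂ := rfl
theorem dataΓ_b₁ : dataΓ.b₁ = !₂[0, 0, 0, 0, 1 / 4, 0] := rfl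
theorem dataΓ_b₂ : dataΓ.b₂ = !₂[0, 0, 0, 0, 0, 1 / 2] := rfl
theorem dataΓ'_B₁ : dataΓ'.B₁ = isoB₁' := rfl
theorem dataΓ'_B₂ : dataΓ'.B₂ = isoB₂' := rfl
theorem dataΓ'_b₁ : dataΓ'.b₁ = !₂[0, 0, 0, 0, 0, 1 / 4] := rfl
theorem dataΓ'_b₂ : dataΓ'.b₂ = !₂[0, 0, 0, 1 / 2, 1 / 2, 0] := rfl

theorem groupΓ_eq : groupΓ = dataΓ.group := by
  rw [groupΓ, PairData.group, dataΓ_B₁, dataΓ_B₂, dataΓ_b₁, dataΓ_b₂]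

theorem groupΓ'_eq : groupΓ' = dataΓ'.group := by
  rw [groupΓ', PairData.group, dataΓ'_B₁, dataΓ'_B₂, dataΓ'_b₁, dataΓ'_b₂]

/-- The centre of `Γ` contains the translations by `e₅` and `e₆`, whereas the centre of `Γ'`
consists of translations by multiples of `e₆`. -/
theorem isEmpty_groupΓ_mulEquiv_groupΓ' : IsEmpty (groupΓ ≃* groupΓ') := by
  rw [groupΓ_eq, groupΓ'_eq]
  refine ⟨fun φ => ?_⟩
  have hmem (k : Fin 6) (m : ℤ) : translation (EuclideanSpace.single k (m : ℝ)) ∈ dataΓ.group :=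
    dataΓ.translation_mem_group (single_mem_latticeSubgroup k m)
  have key : ∀ k : Fin 6, (k = 4 ∨ k = 5) → ∃ m : ℤ,
      (φ ⟨_, hmem k 1⟩ : Isom 6) = translation (EuclideanSpace.single 5 (m : ℝ)) := by
    intro k hk
    have hfix : isoB₁ (EuclideanSpace.single k ((1 : ℤ) : ℝ)) =
          EuclideanSpace.single k ((1 : ℤ) : ℝ) ∧
        isoB₂ (EuclideanSpace.single k ((1 : ℤ) : ℝ)) =
          EuclideanSpace.single k ((1 : ℤ) : ℝ) := by
      rcases hk with rfl | rfl <;> constructor <;> ext i <;>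
        fin_cases i <;> simp [isoB₁_apply, isoB₂_apply]
    obtain ⟨u, hu, h, h1, h2⟩ := dataΓ'.exists_of_commute_all (φ ⟨_, hmem k 1⟩).2 (by
      intro g hg
      have hc := dataΓ.translation_mul_comm_of_fixed hfix.1 hfix.2 (φ.symm ⟨g, hg⟩).2
      have hc' : (⟨_, hmem k 1⟩ : dataΓ.group) * φ.symm ⟨g, hg⟩ = φ.symm ⟨g, hg⟩ * ⟨_, hmem k 1⟩ :=
        Subtype.ext hc
      have := congrArg φ hc'
      rw [map_mul, map_mul, MulEquiv.apply_symm_apply] at this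
      exact (Subtype.ext_iff.1 this).symm)
    obtain ⟨m, hm⟩ := hu 5
    refine ⟨m, h.trans (congrArg translation ?_)⟩
    rw [dataΓ'_B₁, isoB₁'_apply] at h1
    rw [dataΓ'_B₂, isoB₂'_apply] at h2
    have e1 (i : Fin 6) := congrFun (congrArg WithLp.ofLp h1) i
    have e2 (i : Fin 6) := congrFun (congrArg WithLp.ofLp h2) i
    have a0 := e2 0
    have a1 := e2 1
    have a2 := e2 2
    have a3 := e1 3
    have a4 := e1 4
    simp at a0 a1 a2 a3 a4
    ext i
    fin_cases i <;> simp <;> linarith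
  obtain ⟨a, ha⟩ := key 4 (Or.inl rfl)
  obtain ⟨b, hb⟩ := key 5 (Or.inr rfl)
  have hz (k : Fin 6) (c : ℝ) (m : ℤ) : (translation (EuclideanSpace.single k c) : Isom 6) ^ m =
      translation (EuclideanSpace.single k (m * c)) := by
    have hnat (m : ℕ) : (translation (EuclideanSpace.single k c) : Isom 6) ^ m =
        translation (EuclideanSpace.single k (m * c)) := by
      induction m with
      | zero => ext x i; simp [translation_apply]
      | succ m ih =>
        rw [pow_succ, ih]
        ext x i
        rw [isom_mul_apply, translation_apply, translation_apply, translation_apply]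
        by_cases h : i = k <;> simp [h]
        ring
    cases m with
    | ofNat m => simpa using hnat m
    | negSucc m =>
      rw [zpow_negSucc, hnat, inv_eq_iff_mul_eq_one]
      ext x i
      rw [isom_mul_apply, translation_apply, translation_apply]
      by_cases h : i = k <;> simp [h]
      ring
  -- `φ (L_{e₅})ᵇ = φ (L_{e₆})ᵃ`
  have h1 : (⟨_, hmem 4 1⟩ : dataΓ.group) ^ b = (⟨_, hmem 5 1⟩ : dataΓ.group) ^ a := by
    apply φ.injective
    apply Subtype.ext
    rw [map_zpow, map_zpow, Subgroup.coe_zpow, Subgroup.coe_zpow, ha, hb, hz, hz, mul_comm]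
  have h2 := Subtype.ext_iff.1 h1
  rw [Subgroup.coe_zpow, Subgroup.coe_zpow, hz, hz] at h2
  have h3 := DFunLike.congr_fun h2 0
  rw [translation_apply, translation_apply, add_zero, add_zero] at h3
  have h4 := congrFun (congrArg WithLp.ofLp h3) 5
  simp at h4
  have h5 : (φ ⟨_, hmem 5 1⟩ : Isom 6) ≠ 1 := by
    intro h
    have h6 : (⟨_, hmem 5 1⟩ : dataΓ.group) = 1 := by
      apply φ.injective
      rw [map_one]
      exact Subtype.ext h
    have h7 := congrFun (congrArg WithLp.ofLp (DFunLike.congr_fun (Subtype.ext_iff.1 h6) 0)) 5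
    simp [translation_apply] at h7
  have h6 : (φ ⟨_, hmem 4 1⟩ : Isom 6) ≠ 1 := by
    intro h
    have h6 : (⟨_, hmem 4 1⟩ : dataΓ.group) = 1 := by
      apply φ.injective
      rw [map_one]
      exact Subtype.ext h
    have h7 := congrFun (congrArg WithLp.ofLp (DFunLike.congr_fun (Subtype.ext_iff.1 h6) 0)) 4
    simp [translation_apply] at h7
  apply h6
  rw [ha, ← h4]
  ext x i
  simp [translation_apply]

theorem isEmpty_fundamentalGroup_mulEquiv (x : OrbitSpace groupΓ) (x' : OrbitSpace groupΓ') :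
    IsEmpty (FundamentalGroup (OrbitSpace groupΓ) x ≃*
      FundamentalGroup (OrbitSpace groupΓ') x') := by
  have key := isEmpty_groupΓ_mulEquiv_groupΓ'
  revert x x'
  rw [groupΓ_eq, groupΓ'_eq] at key ⊢
  intro x x'
  refine ⟨fun ψ => ?_⟩
  obtain ⟨e⟩ := dataΓ.nonempty_fundamentalGroup_mulEquiv x
  obtain ⟨e'⟩ := dataΓ'.nonempty_fundamentalGroup_mulEquiv x'
  exact key.false (e.symm.trans (ψ.trans e'))

/-! ### The Hodge-Laplacian of flat space -/

/-- The (non-negative) Laplacian `-∑ᵢ ∂ᵢ²` acting on vector-valued functions. -/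
def laplacian {n : ℕ} {V : Type*} [NormedAddCommGroup V] [NormedSpace ℝ V] (f : Euc n → V) :
    Euc n → V := fun x =>
  -∑ i : Fin n, fderiv ℝ (fderiv ℝ f) x (EuclideanSpace.single i 1) (EuclideanSpace.single i 1)

section weitzenboeck

variable {n p : ℕ}

theorem differentiable_fderiv_of_contDiff {V : Type*} [NormedAddCommGroup V] [NormedSpace ℝ V]
    {f : Euc n → V} (h : ContDiff ℝ ∞ f) : Differentiable ℝ (fderiv ℝ f) :=
  (h.fderiv_right (m := ∞) (by simp)).differentiable (by simp)

theorem fderiv_extDeriv_apply {α : PForm n p ℂ} (h : ContDiff ℝ ∞ α) (x v : Euc n) :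
    fderiv ℝ (extDeriv α) x v =
      ContinuousAlternatingMap.alternatizeUncurryFin (fderiv ℝ (fderiv ℝ α) x v) := by
  have h1 : extDeriv α = fun y =>
      ContinuousAlternatingMap.alternatizeUncurryFinCLM ℝ (Euc n) ℂ (n := p) (fderiv ℝ α y) := rfl
  rw [h1]
  have := ((ContinuousAlternatingMap.alternatizeUncurryFinCLM ℝ (Euc n) ℂ
    (n := p)).hasFDerivAt.comp x (differentiable_fderiv_of_contDiff h x).hasFDerivAt).fderiv
  exact DFunLike.congr_fun this v

theorem fderiv_codiff_apply {α : PForm n (p + 1) ℂ} (h : ContDiff ℝ ∞ α) (x v : Euc n) :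
    fderiv ℝ (codiff α) x v = -∑ i : Fin n,
      (fderiv ℝ (fderiv ℝ α) x v (EuclideanSpace.single i 1)).curryLeft
        (EuclideanSpace.single i 1) := by
  have h1 : codiff α = fun y => -∑ i : Fin n, contraction n p (EuclideanSpace.single i 1)
      (fderiv ℝ α y (EuclideanSpace.single i 1)) := rfl
  have h2 : ∀ i : Fin n, HasFDerivAt (fun y => contraction n p (EuclideanSpace.single i 1)
      (fderiv ℝ α y (EuclideanSpace.single i 1)))
      ((contraction n p (EuclideanSpace.single i 1)).comp
        ((fderiv ℝ (fderiv ℝ α) x).flip (EuclideanSpace.single i 1))) x := fun i => by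
    refine (contraction n p (EuclideanSpace.single i 1)).hasFDerivAt.comp x ?_
    have := (differentiable_fderiv_of_contDiff h x).hasFDerivAt.clm_apply
      (hasFDerivAt_const (EuclideanSpace.single i (1 : ℝ)) x)
    simpa using this
  rw [h1, ((HasFDerivAt.fun_sum fun i _ => h2 i).fun_neg).fderiv]
  simp only [neg_apply, sum_apply]
  rfl

/-- Cartan-type identity: contracting an alternatization with the first vector. -/
theorem alternatizeUncurryFin_cons (A : Euc n →L[ℝ] Euc n [⋀^Fin (p + 1)]→L[ℝ] ℂ) (w : Euc n)
    (m : Fin (p + 1) → Euc n) :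
    ContinuousAlternatingMap.alternatizeUncurryFin A (Matrix.vecCons w m) =
      A w m - ∑ k : Fin (p + 1), (-1 : ℤ) ^ (k : ℕ) •
        A (m k) (Matrix.vecCons w (k.removeNth m)) := by
  rw [ContinuousAlternatingMap.alternatizeUncurryFin_apply, Fin.sum_univ_succ, sub_eq_add_neg,
    ← Finset.sum_neg_distrib]
  congr 1
  · simp [Matrix.vecCons]
  · refine Finset.sum_congr rfl fun k _ => ?_
    have h : k.succ.removeNth (Matrix.vecCons w m) = Matrix.vecCons w (k.removeNth m) := by
      ext1 j
      refine Fin.cases ?_ (fun j => ?_) j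
      · simp [Fin.removeNth_apply]
      · simp [Fin.removeNth_apply]
    rw [h, Matrix.cons_val_succ, Fin.val_succ, pow_succ]
    simp

theorem curryLeft_vec_apply (f : Euc n [⋀^Fin (p + 1)]→L[ℝ] ℂ) (w : Euc n)
    (m : Fin p → Euc n) : f.curryLeft w m = f (Matrix.vecCons w m) := rfl

theorem codiff_extDeriv_apply {α : PForm n p ℂ} (h : ContDiff ℝ ∞ α) (x : Euc n)
    (m : Fin p → Euc n) :
    codiff (extDeriv α) x m = -∑ i : Fin n, ContinuousAlternatingMap.alternatizeUncurryFin
      (fderiv ℝ (fderiv ℝ α) x (EuclideanSpace.single i 1))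
      (Matrix.vecCons (EuclideanSpace.single i 1) m) := by
  have h1 : codiff (extDeriv α) x = -∑ i : Fin n,
      (fderiv ℝ (extDeriv α) x (EuclideanSpace.single i 1)).curryLeft
        (EuclideanSpace.single i 1) := rfl
  rw [h1, ContinuousAlternatingMap.neg_apply, ContinuousAlternatingMap.sum_apply]
  congr 1
  refine Finset.sum_congr rfl fun i _ => ?_
  rw [fderiv_extDeriv_apply h, curryLeft_vec_apply]

theorem extDeriv_codiff_apply {α : PForm n (p + 1) ℂ} (h : ContDiff ℝ ∞ α) (x : Euc n)
    (m : Fin (p + 1) → Euc n) :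
    extDeriv (codiff α) x m = -∑ i : Fin n, ∑ k : Fin (p + 1), (-1 : ℤ) ^ (k : ℕ) •
      fderiv ℝ (fderiv ℝ α) x (m k) (EuclideanSpace.single i 1)
        (Matrix.vecCons (EuclideanSpace.single i 1) (k.removeNth m)) := by
  rw [extDeriv, ContinuousAlternatingMap.alternatizeUncurryFin_apply, Finset.sum_comm,
    ← Finset.sum_neg_distrib]
  refine Finset.sum_congr rfl fun k _ => ?_
  rw [fderiv_codiff_apply h, ContinuousAlternatingMap.neg_apply,
    ContinuousAlternatingMap.sum_apply, smul_neg, Finset.smul_sum]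
  rfl

theorem laplacian_apply {α : PForm n p ℂ} (x : Euc n) (m : Fin p → Euc n) :
    laplacian α x m = -∑ i : Fin n, fderiv ℝ (fderiv ℝ α) x (EuclideanSpace.single i 1)
      (EuclideanSpace.single i 1) m := by
  rw [laplacian, ContinuousAlternatingMap.neg_apply, ContinuousAlternatingMap.sum_apply]

/-- On flat space the Hodge-Laplacian acts on the coefficients of a form: the mixed terms of `dδ`
and `δd` cancel because second derivatives are symmetric. -/
theorem hodgeLaplacian_eq_laplacian {α : PForm n p ℂ} (h : ContDiff ℝ ∞ α) :
    hodgeLaplacian p α = laplacian α := by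
  funext x
  ext m
  rw [laplacian_apply]
  cases p with
  | zero =>
    rw [hodgeLaplacian, codiff_extDeriv_apply h]
    congr 1
    refine Finset.sum_congr rfl fun i _ => ?_
    rw [ContinuousAlternatingMap.alternatizeUncurryFin_apply]
    simp
  | succ p =>
    have hsymm : IsSymmSndFDerivAt ℝ α x :=
      (h.contDiffAt (x := x)).isSymmSndFDerivAt (by simp; exact WithTop.coe_le_coe.2 le_top)
    rw [hodgeLaplacian, Pi.add_apply, ContinuousAlternatingMap.add_apply,
      codiff_extDeriv_apply h, extDeriv_codiff_apply h]
    simp only [alternatizeUncurryFin_cons, Finset.sum_sub_distrib]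
    have h4 : ∀ (k : Fin (p + 1)) (i : Fin n),
        fderiv ℝ (fderiv ℝ α) x (m k) (EuclideanSpace.single i 1) =
          fderiv ℝ (fderiv ℝ α) x (EuclideanSpace.single i 1) (m k) := fun k i => hsymm.eq _ _
    simp only [h4]
    abel

end weitzenboeck

/-! ### Periodic eigenfunctions are trigonometric polynomials -/

/-- The exponential `x ↦ exp (2πi ⟨v, x⟩)`. -/
def expChar {n : ℕ} (v x : Euc n) : ℂ := Complex.exp (2 * Real.pi * Complex.I * (inner ℝ v x : ℝ))

theorem expChar_add_right {n : ℕ} (v x y : Euc n) :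
    expChar v (x + y) = expChar v x * expChar v y := by
  rw [expChar, expChar, expChar, ← Complex.exp_add, inner_add_right]
  push_cast
  ring_nf

theorem expChar_eq_one {n : ℕ} {v x : Euc n} (h : ∃ m : ℤ, inner ℝ v x = m) :
    expChar v x = 1 := by
  obtain ⟨m, hm⟩ := h
  rw [expChar, hm, Complex.exp_eq_one_iff]
  exact ⟨m, by push_cast; ring⟩

theorem expChar_add_lattice {n : ℕ} {v u : Euc n} (hv : v ∈ latticeSubgroup n)
    (hu : u ∈ latticeSubgroup n) (x : Euc n) : expChar v (x + u) = expChar v x := by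
  rw [expChar_add_right, expChar_eq_one (exists_inner_eq_intCast hv hu), mul_one]

section torus

variable {n : ℕ}

/-- The normalised Haar measure on `ℝ / ℤ`, with respect to which `UnitAddTorus.mFourierCoeff`
is defined. -/
local instance circleMeasureSpace : MeasureTheory.MeasureSpace UnitAddCircle :=
  ⟨AddCircle.haarAddCircle⟩

local instance circleIsAddHaarMeasure :
    (MeasureTheory.volume : MeasureTheory.Measure UnitAddCircle).IsAddHaarMeasure :=
  inferInstanceAs (MeasureTheory.Measure.IsAddHaarMeasure AddCircle.haarAddCircle)

local instance circleIsProbabilityMeasure :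
    MeasureTheory.IsProbabilityMeasure
      (MeasureTheory.volume : MeasureTheory.Measure UnitAddCircle) :=
  inferInstanceAs (MeasureTheory.IsProbabilityMeasure AddCircle.haarAddCircle)

/-- The projection `ℝⁿ → ℝⁿ / ℤⁿ`. -/
def torusProj (x : Euc n) : UnitAddTorus (Fin n) := fun i => (x i : UnitAddCircle)

/-- The function on the torus induced by a `ℤⁿ`-periodic function, defined through the
representatives in `[0, 1)ⁿ`. -/
def torusLift (f : Euc n → ℂ) (t : UnitAddTorus (Fin n)) : ℂ :=
  f (WithLp.toLp 2 fun i => (AddCircle.equivIco 1 0 (t i) : ℝ))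

/-- Periodicity with respect to `ℤⁿ`. -/
def LatticePeriodic (f : Euc n → ℂ) : Prop := ∀ x, ∀ u ∈ latticeSubgroup n, f (x + u) = f x

theorem torusProj_add (x y : Euc n) : torusProj (x + y) = torusProj x + torusProj y := rfl

theorem isOpenQuotientMap_torusProj : IsOpenQuotientMap (torusProj (n := n)) := by
  have h : IsOpenQuotientMap (fun (x : Fin n → ℝ) (i : Fin n) => (x i : UnitAddCircle)) :=
    IsOpenQuotientMap.piMap fun _ => QuotientAddGroup.isOpenQuotientMap_mk
  exact h.comp (PiLp.homeomorph 2 fun _ : Fin n => ℝ).isOpenQuotientMap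

theorem torusLift_torusProj {f : Euc n → ℂ} (hf : LatticePeriodic f) (x : Euc n) :
    torusLift f (torusProj x) = f x := by
  rw [torusLift]
  have hu : (WithLp.toLp 2 fun i => (-⌊x i⌋ : ℝ) : Euc n) ∈ latticeSubgroup n :=
    fun i => ⟨-⌊x i⌋, by simp⟩
  rw [← hf x _ hu]
  congr 1
  ext i
  simp [torusProj, AddCircle.coe_equivIco_mk_apply, Int.fract, sub_eq_add_neg]

theorem continuous_torusLift {f : Euc n → ℂ} (hc : Continuous f) (hf : LatticePeriodic f) :
    Continuous (torusLift f) := by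
  rw [isOpenQuotientMap_torusProj.isQuotientMap.continuous_iff]
  convert hc using 1
  exact funext (torusLift_torusProj hf)

theorem mFourier_torusProj (k : Fin n → ℤ) (x : Euc n) :
    UnitAddTorus.mFourier k (torusProj x) = expChar (WithLp.toLp 2 fun i => (k i : ℝ)) x := by
  simp only [UnitAddTorus.mFourier, torusProj, ContinuousMap.coe_mk, fourier_coe_apply, expChar]
  rw [← Complex.exp_sum]
  congr 1
  rw [PiLp.inner_apply]
  push_cast
  rw [Finset.mul_sum]
  refine Finset.sum_congr rfl fun i _ => ?_
  simp
  ring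

theorem mFourier_add_right (k : Fin n → ℤ) (s t : UnitAddTorus (Fin n)) :
    UnitAddTorus.mFourier k (s + t) = UnitAddTorus.mFourier k s * UnitAddTorus.mFourier k t := by
  obtain ⟨x, rfl⟩ := isOpenQuotientMap_torusProj.surjective s
  obtain ⟨y, rfl⟩ := isOpenQuotientMap_torusProj.surjective t
  rw [← torusProj_add, mFourier_torusProj, mFourier_torusProj, mFourier_torusProj,
    expChar_add_right]

/-- The Fourier coefficient of a periodic function. -/
def coeff (f : Euc n → ℂ) (k : Fin n → ℤ) : ℂ := UnitAddTorus.mFourierCoeff (torusLift f) k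

theorem coeff_translate {f : Euc n → ℂ} (k : Fin n → ℤ) (a : UnitAddTorus (Fin n)) :
    ∫ t, UnitAddTorus.mFourier (-k) t * torusLift f (t + a) =
      UnitAddTorus.mFourier k a * coeff f k := by
  have h1 := MeasureTheory.integral_add_right_eq_self (μ := MeasureTheory.volume)
    (fun t => UnitAddTorus.mFourier k a * (UnitAddTorus.mFourier (-k) t * torusLift f t)) a
  refine Eq.trans ?_ (h1.trans (MeasureTheory.integral_const_mul _ _))
  refine MeasureTheory.integral_congr_ae (Filter.Eventually.of_forall fun t => ?_)
  have h2 : UnitAddTorus.mFourier k a * UnitAddTorus.mFourier (-k) a = 1 := by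
    rw [← UnitAddTorus.mFourier_add, add_neg_cancel, UnitAddTorus.mFourier_zero]
    rfl
  simp only [mFourier_add_right]
  linear_combination (-UnitAddTorus.mFourier (-k) t * torusLift f (t + a)) * h2

theorem LatticePeriodic.fderiv {f : Euc n → ℂ} (hf : LatticePeriodic f) (v : Euc n) :
    LatticePeriodic (fun x => fderiv ℝ f x v) := by
  intro x u hu
  have h : (fun y => f (y + u)) = f := funext fun y => hf y u hu
  have h2 := fderiv_comp_add_right (𝕜 := ℝ) (f := f) (x := x) u
  rw [h] at h2
  simp only [h2]

theorem contDiff_fderiv_apply {f : Euc n → ℂ} (hf : ContDiff ℝ ∞ f) (v : Euc n) :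
    ContDiff ℝ ∞ (fun x => fderiv ℝ f x v) :=
  (hf.fderiv_right (m := ∞) (by simp)).clm_apply contDiff_const

/-- Differentiation multiplies Fourier coefficients: both sides are the derivative at `0` of the
Fourier coefficient of the translated function. -/
theorem coeff_fderiv {f : Euc n → ℂ} (hs : ContDiff ℝ ∞ f) (hf : LatticePeriodic f)
    (k : Fin n → ℤ) (v : Euc n) :
    coeff (fun x => fderiv ℝ f x v) k =
      2 * Real.pi * Complex.I * (inner ℝ (WithLp.toLp 2 fun i => (k i : ℝ)) v : ℝ) * coeff f k := by
  set w : Euc n := WithLp.toLp 2 fun i => (k i : ℝ) with hw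
  have hs' := contDiff_fderiv_apply hs v
  have hf' := hf.fderiv v
  have hc : Continuous (torusLift f) := continuous_torusLift hs.continuous hf
  have hc' : Continuous (torusLift fun x => fderiv ℝ f x v) :=
    continuous_torusLift hs'.continuous hf'
  have hpath : ∀ s : ℝ, Continuous fun t : UnitAddTorus (Fin n) => t + torusProj (s • v) :=
    fun s => continuous_add_const _
  obtain ⟨C, hC⟩ := (isCompact_univ.image hc').isBounded.exists_norm_le
  have h1 : HasDerivAt (fun s : ℝ => ∫ t, UnitAddTorus.mFourier (-k) t *
      torusLift f (t + torusProj (s • v)))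
      (∫ t, UnitAddTorus.mFourier (-k) t *
        torusLift (fun x => fderiv ℝ f x v) (t + torusProj ((0 : ℝ) • v))) 0 := by
    refine (hasDerivAt_integral_of_dominated_loc_of_deriv_le (μ := MeasureTheory.volume)
      (F := fun (s : ℝ) (t : UnitAddTorus (Fin n)) => UnitAddTorus.mFourier (-k) t *
        torusLift f (t + torusProj (s • v)))
      (F' := fun (s : ℝ) (t : UnitAddTorus (Fin n)) => UnitAddTorus.mFourier (-k) t *
        torusLift (fun x => fderiv ℝ f x v) (t + torusProj (s • v)))
      (bound := fun _ => C) (s := Set.univ) Filter.univ_mem ?_ ?_ ?_ ?_ ?_ ?_).2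
    · refine Filter.Eventually.of_forall fun s => Continuous.aestronglyMeasurable ?_
      exact (UnitAddTorus.mFourier (-k)).continuous.mul (hc.comp (hpath s))
    · refine Continuous.integrable_of_hasCompactSupport ?_ (HasCompactSupport.of_compactSpace _)
      exact (UnitAddTorus.mFourier (-k)).continuous.mul (hc.comp (hpath 0))
    · refine Continuous.aestronglyMeasurable ?_
      exact (UnitAddTorus.mFourier (-k)).continuous.mul (hc'.comp (hpath 0))
    · refine Filter.Eventually.of_forall fun t s _ => ?_
      rw [norm_mul]
      have h3 : ‖UnitAddTorus.mFourier (-k) t‖ ≤ 1 :=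
        ((UnitAddTorus.mFourier (-k)).norm_coe_le_norm t).trans UnitAddTorus.mFourier_norm.le
      have h4 := hC _ ⟨t + torusProj (s • v), trivial, rfl⟩
      calc _ ≤ 1 * C := mul_le_mul h3 h4 (norm_nonneg _) zero_le_one
        _ = C := one_mul C
    · exact MeasureTheory.integrable_const _
    · refine Filter.Eventually.of_forall fun t s _ => ?_
      obtain ⟨x, rfl⟩ := isOpenQuotientMap_torusProj.surjective t
      simp only [← torusProj_add, torusLift_torusProj hf, torusLift_torusProj hf']
      refine HasDerivAt.const_mul _ ?_
      have h5 : HasDerivAt (fun s : ℝ => x + s • v) v s := by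
        simpa using ((hasDerivAt_id s).smul_const v).const_add x
      exact (hs.differentiable (by simp) (x + s • v)).hasFDerivAt.comp_hasDerivAt s h5
  have h2 : HasDerivAt (fun s : ℝ => ∫ t, UnitAddTorus.mFourier (-k) t *
      torusLift f (t + torusProj (s • v)))
      (2 * Real.pi * Complex.I * (inner ℝ w v : ℝ) * coeff f k) 0 := by
    simp only [coeff_translate, mFourier_torusProj, ← hw, expChar, inner_smul_right]
    refine HasDerivAt.mul_const ?_ _
    have h6 : HasDerivAt (fun s : ℝ => 2 * Real.pi * Complex.I * ((s * inner ℝ w v : ℝ) : ℂ))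
        (2 * Real.pi * Complex.I * (inner ℝ w v : ℝ)) 0 := by
      refine HasDerivAt.const_mul _ ?_
      simpa using ((hasDerivAt_id (0 : ℝ)).mul_const (inner ℝ w v)).ofReal_comp
    simpa using h6.cexp
  have h7 := h1.unique h2
  rw [← h7, coeff_translate]
  have h8 : torusProj ((0 : ℝ) • v) = 0 := by ext i; simp [torusProj]
  have h9 : UnitAddTorus.mFourier k (0 : UnitAddTorus (Fin n)) = 1 := by
    simp [UnitAddTorus.mFourier]
  rw [h8, h9, one_mul]

theorem fderiv_fderiv_apply {f : Euc n → ℂ} (hs : ContDiff ℝ ∞ f) (x v w : Euc n) :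
    fderiv ℝ (fun y => fderiv ℝ f y v) x w = fderiv ℝ (fderiv ℝ f) x w v := by
  have := (differentiable_fderiv_of_contDiff hs x).hasFDerivAt.clm_apply (hasFDerivAt_const v x)
  rw [this.fderiv]
  simp

theorem coeff_laplacian {f : Euc n → ℂ} (hs : ContDiff ℝ ∞ f) (hf : LatticePeriodic f)
    (k : Fin n → ℤ) :
    coeff (laplacian f) k =
      ((4 * Real.pi ^ 2 * ‖(WithLp.toLp 2 fun i => (k i : ℝ) : Euc n)‖ ^ 2 : ℝ) : ℂ) *
        coeff f k := by
  have h1 : ∀ i : Fin n, Continuous (torusLift fun x =>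
      fderiv ℝ (fun y => fderiv ℝ f y (EuclideanSpace.single i 1)) x (EuclideanSpace.single i 1)) :=
    fun i => continuous_torusLift (contDiff_fderiv_apply (contDiff_fderiv_apply hs _) _).continuous
      ((hf.fderiv _).fderiv _)
  have h2 : coeff (laplacian f) k = -∑ i : Fin n, coeff (fun x =>
      fderiv ℝ (fun y => fderiv ℝ f y (EuclideanSpace.single i 1)) x
        (EuclideanSpace.single i 1)) k := by
    simp only [coeff, UnitAddTorus.mFourierCoeff]
    rw [← MeasureTheory.integral_finsetSum, ← MeasureTheory.integral_neg]
    · congr 1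
      funext t
      simp only [torusLift, laplacian, fderiv_fderiv_apply hs, smul_eq_mul, Finset.mul_sum, mul_neg]
    · intro i _
      refine Continuous.integrable_of_hasCompactSupport ?_ (HasCompactSupport.of_compactSpace _)
      exact (UnitAddTorus.mFourier (-k)).continuous.smul (h1 i)
  rw [h2]
  simp only [coeff_fderiv (contDiff_fderiv_apply hs _) (hf.fderiv _), coeff_fderiv hs hf]
  rw [EuclideanSpace.norm_sq_eq]
  simp only [EuclideanSpace.inner_single_right, Real.norm_eq_abs, sq_abs]
  push_cast
  rw [Finset.mul_sum, Finset.sum_mul, ← Finset.sum_neg_distrib]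
  refine Finset.sum_congr rfl fun i _ => ?_
  have := Complex.I_sq
  simp
  linear_combination (-(4 * Real.pi ^ 2 * (k i) ^ 2 * coeff f k) : ℂ) * this

end torus

/-- The lattice vectors of squared length `μ`. -/
def shell (n : ℕ) (μ : ℝ) : Set (Euc n) := {v | v ∈ latticeSubgroup n ∧ ‖v‖ ^ 2 = μ}

theorem finite_shell (n : ℕ) (μ : ℝ) : (shell n μ).Finite := by
  refine (finite_latticeSubgroup_norm_le n (√μ)).subset ?_
  rintro v ⟨hv, rfl⟩
  exact ⟨hv, by rw [Real.sqrt_sq (norm_nonneg v)]⟩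

instance fintypeShell (n : ℕ) (μ : ℝ) : Fintype (shell n μ) := (finite_shell n μ).fintype

/-- A smooth `ℤⁿ`-periodic eigenfunction of the Laplacian is a combination of the finitely many
exponentials with the same eigenvalue. -/
theorem exists_eq_sum_expChar {n : ℕ} {f : Euc n → ℂ} {lam : ℝ} (hs : ContDiff ℝ ∞ f)
    (hf : LatticePeriodic f) (hlam : laplacian f = (lam : ℂ) • f) :
    ∃ c : shell n (lam / (4 * Real.pi ^ 2)) → ℂ, ∀ x, f x = ∑ v, c v * expChar v.1 x := by
  set μ := lam / (4 * Real.pi ^ 2) with hμ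
  have hpi : (4 * Real.pi ^ 2 : ℝ) ≠ 0 := by positivity
  let ι : shell n μ ↪ (Fin n → ℤ) := ⟨fun v i => ⌊v.1 i⌋, by
    intro v w h
    ext i
    obtain ⟨k, hk⟩ := v.2.1 i
    obtain ⟨l, hl⟩ := w.2.1 i
    have := congrFun h i
    simp only [hk, hl, Int.floor_intCast] at this
    rw [hk, hl, this]⟩
  have hι : ∀ v : shell n μ, (WithLp.toLp 2 fun i => (ι v i : ℝ) : Euc n) = v.1 := by
    intro v
    ext i
    obtain ⟨k, hk⟩ := v.2.1 i
    change (⌊v.1 i⌋ : ℝ) = v.1 i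
    rw [hk, Int.floor_intCast]
  let T : Finset (Fin n → ℤ) := Finset.univ.map ι
  have hzero : ∀ k ∉ T, coeff f k = 0 := by
    intro k hk
    by_contra hne
    have h1 := coeff_laplacian hs hf k
    have h2 : coeff ((lam : ℂ) • f) k = lam * coeff f k := by
      simp only [coeff, UnitAddTorus.mFourierCoeff]
      rw [← MeasureTheory.integral_const_mul]
      congr 1
      funext t
      simp only [torusLift, Pi.smul_apply, smul_eq_mul]
      ring
    rw [hlam, h2] at h1
    have h3 := mul_right_cancel₀ hne h1
    have h4 := Complex.ofReal_injective h3
    apply hk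
    rw [Finset.mem_map]
    refine ⟨⟨WithLp.toLp 2 fun i => (k i : ℝ), fun i => ⟨k i, rfl⟩, ?_⟩, Finset.mem_univ _, ?_⟩
    · rw [hμ, h4]
      field_simp
    · funext i
      exact Int.floor_intCast (R := ℝ) (k i)
  refine ⟨fun v => coeff f (ι v), fun x => ?_⟩
  let F : C(UnitAddTorus (Fin n), ℂ) := ⟨torusLift f, continuous_torusLift hs.continuous hf⟩
  have hsum := UnitAddTorus.hasSum_mFourier_series_apply_of_summable (f := F)
    (summable_of_ne_finset_zero (s := T) hzero) (torusProj x)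
  have hfin : HasSum
      (fun k => UnitAddTorus.mFourierCoeff F k • UnitAddTorus.mFourier k (torusProj x))
      (∑ k ∈ T, UnitAddTorus.mFourierCoeff F k • UnitAddTorus.mFourier k (torusProj x)) :=
    hasSum_sum_of_ne_finset_zero (fun k hk => by
      have : UnitAddTorus.mFourierCoeff F k = 0 := hzero k hk
      rw [this, zero_smul])
  have h5 := hsum.unique hfin
  change torusLift f (torusProj x) = _ at h5
  rw [torusLift_torusProj hf] at h5
  rw [h5, Finset.sum_map]
  refine Finset.sum_congr rfl fun v _ => ?_
  rw [mFourier_torusProj, hι]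
  rfl

/-! ### Trigonometric sums over a shell of lattice vectors -/

section trigSum

variable {n : ℕ} {μ : ℝ}

/-- The trigonometric sum `x ↦ ∑ c(v) exp (2πi ⟨v, x⟩)`. -/
def trigSum (c : shell n μ → ℂ) (x : Euc n) : ℂ := ∑ v, c v * expChar v.1 x

/-- The differential of the phase `x ↦ 2πi ⟨v, x⟩`. -/
def phaseCLM (v : Euc n) : Euc n →L[ℝ] ℂ :=
  (2 * Real.pi * Complex.I) • Complex.ofRealCLM.comp (innerSL ℝ v)

theorem phaseCLM_apply (v x : Euc n) :
    phaseCLM v x = 2 * Real.pi * Complex.I * (inner ℝ v x : ℝ) := rfl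

theorem hasFDerivAt_expChar (v x : Euc n) :
    HasFDerivAt (expChar v) (expChar v x • phaseCLM v) x := by
  have h : expChar v = fun x => Complex.exp (phaseCLM v x) := rfl
  rw [h]
  exact (phaseCLM v).hasFDerivAt.cexp

theorem contDiff_expChar (v : Euc n) : ContDiff ℝ ∞ (expChar v) :=
  (phaseCLM v).contDiff.cexp

theorem contDiff_trigSum (c : shell n μ → ℂ) : ContDiff ℝ ∞ (trigSum c) :=
  ContDiff.sum fun v _ => contDiff_const.mul (contDiff_expChar v.1)

theorem laplacian_trigSum (c : shell n μ → ℂ) :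
    laplacian (trigSum c) = ((4 * Real.pi ^ 2 * μ : ℝ) : ℂ) • trigSum c := by
  have h1 : fderiv ℝ (trigSum c) = fun x => ∑ v, (c v * expChar v.1 x) • phaseCLM v.1 := by
    funext x
    have : HasFDerivAt (trigSum c) (∑ v, c v • (expChar v.1 x • phaseCLM v.1)) x :=
      HasFDerivAt.fun_sum fun v _ => (hasFDerivAt_expChar v.1 x).const_mul (c v)
    rw [this.fderiv]
    simp only [smul_smul]
  funext x
  have h2 : HasFDerivAt (fderiv ℝ (trigSum c)) (∑ v, ((c v • (expChar v.1 x • phaseCLM v.1)) :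
      Euc n →L[ℝ] ℂ).smulRight (phaseCLM v.1)) x := by
    rw [h1]
    exact HasFDerivAt.fun_sum fun v _ =>
      ((hasFDerivAt_expChar v.1 x).const_mul (c v)).smul_const (phaseCLM v.1)
  simp only [laplacian, h2.fderiv, sum_apply, ContinuousLinearMap.smulRight_apply, smul_apply,
    smul_eq_mul, Pi.smul_apply, trigSum]
  rw [Finset.sum_comm, ← Finset.sum_neg_distrib, Finset.mul_sum]
  refine Finset.sum_congr rfl fun v _ => ?_
  have hμ : μ = ∑ i, v.1 i ^ 2 := by
    rw [← EuclideanSpace.real_norm_sq_eq, v.2.2]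
  have hμ' : 4 * Real.pi ^ 2 * μ = 4 * Real.pi ^ 2 * ∑ i, v.1 i ^ 2 := congrArg _ hμ
  rw [hμ']
  simp only [phaseCLM_apply, EuclideanSpace.inner_single_right]
  push_cast
  rw [Finset.mul_sum, Finset.sum_mul, ← Finset.sum_neg_distrib]
  refine Finset.sum_congr rfl fun i _ => ?_
  simp
  linear_combination (-(4 * Real.pi ^ 2 * (v.1 i) ^ 2 * c v * expChar v.1 x) : ℂ) * Complex.I_sq

theorem expChar_injective : Function.Injective (expChar (n := n)) := by
  intro v w h
  by_contra hne
  have hu : inner ℝ (v - w) (v - w) ≠ 0 := by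
    rw [inner_self_ne_zero]
    exact sub_ne_zero.2 hne
  have h1 := congrFun h ((1 / (2 * inner ℝ (v - w) (v - w))) • (v - w))
  have h2 : inner ℝ v ((1 / (2 * inner ℝ (v - w) (v - w))) • (v - w)) =
      inner ℝ w ((1 / (2 * inner ℝ (v - w) (v - w))) • (v - w)) + 1 / 2 := by
    rw [← sub_eq_iff_eq_add', ← inner_sub_left, inner_smul_right]
    field_simp
  rw [expChar, expChar, h2] at h1
  push_cast at h1
  rw [mul_add, Complex.exp_add, show 2 * (Real.pi : ℂ) * Complex.I * (1 / 2) =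
    Real.pi * Complex.I by ring, Complex.exp_pi_mul_I] at h1
  have h3 := Complex.exp_ne_zero (2 * (Real.pi : ℂ) * Complex.I *
    (inner ℝ w ((1 / (2 * inner ℝ (v - w) (v - w))) • (v - w)) : ℝ))
  apply h3
  linear_combination (-1 / 2 : ℂ) * h1

/-- Distinct exponentials are linearly independent, being distinct characters of `ℝⁿ`. -/
theorem trigSum_injective : Function.Injective (trigSum (n := n) (μ := μ)) := by
  let χ : Euc n → (Multiplicative (Euc n) →* ℂ) := fun v =>
    { toFun := fun x => expChar v x.toAdd
      map_one' := by simp [expChar]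
      map_mul' := fun x y => expChar_add_right v x.toAdd y.toAdd }
  have hχ : Function.Injective fun v : shell n μ => χ v.1 := by
    intro v w h
    refine Subtype.ext (expChar_injective (funext fun x => ?_))
    exact DFunLike.congr_fun h (Multiplicative.ofAdd x)
  have hli := (linearIndependent_monoidHom (Multiplicative (Euc n)) ℂ).comp _ hχ
  intro c d h
  funext v
  refine sub_eq_zero.1 (Fintype.linearIndependent_iff.1 hli (c - d) ?_ v)
  funext x
  have := congrFun h x.toAdd
  simp only [trigSum] at this
  simp only [Finset.sum_apply, Pi.smul_apply, Pi.sub_apply, smul_eq_mul, Function.comp_apply,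
    Pi.zero_apply, sub_mul, Finset.sum_sub_distrib]
  exact sub_eq_zero.2 this

end trigSum

/-! ### The multiplicity as an average of exponential sums -/

namespace PairData

variable {n : ℕ} (D : PairData n) (μ : ℝ)

/-- The permutation `v ↦ B₁ⁱ B₂ʲ v` of the lattice vectors of squared length `μ`. -/
def act (a : ZMod 4 × ZMod 2) (v : shell n μ) : shell n μ :=
  ⟨D.rot a.1.val a.2.val v.1, D.rot_apply_mem _ _ v.2.1, by
    rw [LinearIsometryEquiv.norm_map]; exact v.2.2⟩

theorem rot_val_add (a b : ZMod 4 × ZMod 2) :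
    D.rot (a + b).1.val (a + b).2.val = D.rot a.1.val a.2.val * D.rot b.1.val b.2.val := by
  rw [rot_mul, D.rot_mod (_ + _), Prod.fst_add, Prod.snd_add, ZMod.val_add, ZMod.val_add]

theorem shift_val_add (a b : ZMod 4 × ZMod 2) : ∃ u ∈ latticeSubgroup n,
    D.shift a.1.val a.2.val + D.shift b.1.val b.2.val =
      D.shift (a + b).1.val (a + b).2.val + u := by
  refine ⟨_, D.shift_sub_mod_mem (a.1.val + b.1.val) (a.2.val + b.2.val), ?_⟩
  rw [shift_add, Prod.fst_add, Prod.snd_add, ZMod.val_add, ZMod.val_add]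
  abel

theorem act_add (a b : ZMod 4 × ZMod 2) (v : shell n μ) :
    D.act μ (a + b) v = D.act μ a (D.act μ b v) := by
  apply Subtype.ext
  change D.rot _ _ v.1 = D.rot _ _ (D.rot _ _ v.1)
  rw [rot_val_add]
  rfl

theorem act_zero (v : shell n μ) : D.act μ 0 v = v := by
  apply Subtype.ext
  change D.rot 0 0 v.1 = v.1
  rw [rot_zero]
  rfl

theorem act_bijective (a : ZMod 4 × ZMod 2) : Function.Bijective (D.act μ a) := by
  refine Function.bijective_iff_has_inverse.2 ⟨D.act μ (-a), fun v => ?_, fun v => ?_⟩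
  · rw [← act_add, neg_add_cancel, act_zero]
  · rw [← act_add, add_neg_cancel, act_zero]

/-- Rotating a lattice vector does not change its pairing with the translation vectors of the
group modulo integers. -/
theorem expChar_rot_shift (i j k l : ℕ) {v : Euc n} (hv : v ∈ latticeSubgroup n) :
    expChar (D.rot i j v) (D.shift k l) = expChar v (D.shift k l) := by
  have h1 : inner ℝ (D.rot i j v) (D.shift k l) = inner ℝ v ((D.rot i j)⁻¹ (D.shift k l)) := by
    rw [← LinearIsometryEquiv.inner_map_map (D.rot i j) v]
    congr 1
    exact ((D.rot i j).apply_symm_apply _).symm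
  have h2 : expChar (D.rot i j v) (D.shift k l) = expChar v ((D.rot i j)⁻¹ (D.shift k l)) := by
    rw [expChar, h1, expChar]
  have h3 := D.rot_shift_sub_mem (3 * i) j k l
  rw [← rot_inv] at h3
  rw [h2, ← expChar_add_lattice hv h3 (D.shift k l), add_sub_cancel]

/-- The action of the holonomy group on the coefficients of trigonometric sums. -/
def coeffRep : Representation ℂ (Multiplicative (ZMod 4 × ZMod 2)) (shell n μ → ℂ) where
  toFun a :=
    { toFun := fun c v => expChar v.1 (D.shift a.toAdd.1.val a.toAdd.2.val) *
        c (D.act μ a.toAdd v)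
      map_add' := fun c d => by funext v; simp [mul_add]
      map_smul' := fun r c => by
        funext v
        simp only [Pi.smul_apply, smul_eq_mul, RingHom.id_apply]
        ring }
  map_one' := by
    refine LinearMap.ext fun c => funext fun v => ?_
    change expChar v.1 (D.shift 0 0) * c (D.act μ 0 v) = c v
    rw [shift_zero, act_zero, expChar_eq_one ⟨0, by simp⟩, one_mul]
  map_mul' a b := by
    refine LinearMap.ext fun c => funext fun v => ?_
    change expChar v.1 (D.shift (a.toAdd + b.toAdd).1.val (a.toAdd + b.toAdd).2.val) *
        c (D.act μ (a.toAdd + b.toAdd) v) =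
      expChar v.1 (D.shift a.toAdd.1.val a.toAdd.2.val) *
        (expChar (D.rot a.toAdd.1.val a.toAdd.2.val v.1)
          (D.shift b.toAdd.1.val b.toAdd.2.val) * c (D.act μ b.toAdd (D.act μ a.toAdd v)))
    obtain ⟨u, hu, h⟩ := D.shift_val_add a.toAdd b.toAdd
    rw [expChar_rot_shift _ _ _ _ _ v.2.1, ← act_add, ← mul_assoc, ← expChar_add_right, h,
      expChar_add_lattice v.2.1 hu, add_comm a.toAdd]

theorem coeffRep_apply (a : ZMod 4 × ZMod 2) (c : shell n μ → ℂ) (v : shell n μ) :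
    D.coeffRep μ (Multiplicative.ofAdd a) c v =
      expChar v.1 (D.shift a.1.val a.2.val) * c (D.act μ a v) := rfl

/-- Pulling back a trigonometric sum by an element of the group. -/
theorem trigSum_motion (a : ZMod 4 × ZMod 2) {u : Euc n} (hu : u ∈ latticeSubgroup n)
    (c : shell n μ → ℂ) (x : Euc n) :
    trigSum c (motion (D.rot a.1.val a.2.val) (D.shift a.1.val a.2.val + u) x) =
      trigSum (D.coeffRep μ (Multiplicative.ofAdd a) c) x := by
  rw [trigSum, trigSum, ← (D.act_bijective μ a).sum_comp]
  refine Finset.sum_congr rfl fun v _ => ?_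
  rw [coeffRep_apply, motion_apply]
  have h1 : expChar (D.act μ a v).1 (D.rot a.1.val a.2.val (x + (D.shift a.1.val a.2.val + u))) =
      expChar v.1 (x + D.shift a.1.val a.2.val + u) := by
    rw [← add_assoc, expChar, expChar]
    change Complex.exp (_ * ((inner ℝ (D.rot _ _ v.1) _ : ℝ) : ℂ)) = _
    rw [LinearIsometryEquiv.inner_map_map]
  rw [h1, expChar_add_lattice v.2.1 hu, expChar_add_right]
  ring

theorem exists_motion_eq {g : Isom n} (hg : g ∈ D.group) : ∃ a : ZMod 4 × ZMod 2,
    ∃ u ∈ latticeSubgroup n, g = motion (D.rot a.1.val a.2.val) (D.shift a.1.val a.2.val + u) := by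
  obtain ⟨i, hi, j, hj, u, hu, h⟩ := D.exists_of_mem_group hg
  refine ⟨(i, j), u, hu, ?_⟩
  change _ = motion (D.rot (i : ZMod 4).val (j : ZMod 2).val)
    (D.shift (i : ZMod 4).val (j : ZMod 2).val + u)
  rw [ZMod.val_natCast_of_lt hi, ZMod.val_natCast_of_lt hj, h]

theorem trigSum_invariant_iff (c : shell n μ → ℂ) :
    (∀ g ∈ D.group, ∀ x, trigSum c (g x) = trigSum c x) ↔
      c ∈ (D.coeffRep μ).invariants := by
  rw [Representation.mem_invariants]
  constructor
  · intro h a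
    refine trigSum_injective (funext fun x => ?_)
    have h1 := D.trigSum_motion μ a.toAdd (zero_mem _) c x
    rw [h _ (D.motion_mem_group _ _ (zero_mem _))] at h1
    exact h1.symm
  · intro h g hg x
    obtain ⟨a, u, hu, rfl⟩ := D.exists_motion_eq hg
    rw [trigSum_motion _ _ _ hu, h]

theorem trace_coeffRep (a : ZMod 4 × ZMod 2) :
    LinearMap.trace ℂ _ (D.coeffRep μ (Multiplicative.ofAdd a)) =
      ∑ v : shell n μ, Set.indicator {v : Euc n | D.rot a.1.val a.2.val v = v}
        (fun v => expChar v (D.shift a.1.val a.2.val)) v.1 := by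
  classical
  rw [LinearMap.trace_eq_matrix_trace ℂ (Pi.basisFun ℂ (shell n μ)), Matrix.trace]
  refine Finset.sum_congr rfl fun v _ => ?_
  rw [Matrix.diag_apply, LinearMap.toMatrix_apply, Pi.basisFun_apply, Pi.basisFun_repr,
    coeffRep_apply]
  by_cases h : D.rot a.1.val a.2.val v.1 = v.1
  · have h' : D.act μ a v = v := Subtype.ext h
    rw [h', Pi.single_eq_same, mul_one, Set.indicator_of_mem
      (show v.1 ∈ {v : Euc n | D.rot a.1.val a.2.val v = v} from h)]
  · have h' : D.act μ a v ≠ v := fun h' => h (Subtype.ext_iff.1 h')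
    rw [Pi.single_eq_of_ne h', mul_zero, Set.indicator_of_notMem
      (show v.1 ∉ {v : Euc n | D.rot a.1.val a.2.val v = v} from h)]

theorem expSum_rot {i j : ℕ} (hi : i < 4) (hj : j < 2) :
    expSum D.group μ (D.rot i j) =
      ∑ᶠ v ∈ {v : Euc n | v ∈ latticeSubgroup n ∧ ‖v‖ ^ 2 = μ ∧ D.rot i j v = v},
        expChar v (D.shift i j) := by
  obtain ⟨u, hu, h⟩ := D.translationPart_rot hi hj
  have hset : {v : Euc n | v ∈ dualLattice D.group ∧ ‖v‖ ^ 2 = μ ∧ D.rot i j v = v} =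
      {v : Euc n | v ∈ latticeSubgroup n ∧ ‖v‖ ^ 2 = μ ∧ D.rot i j v = v} := by
    rw [dualLattice_group]
    rfl
  rw [expSum, hset, h]
  exact finsum_mem_congr rfl fun v hv => expChar_add_lattice hv.1 hu _

theorem expSum_eq_trace (a : ZMod 4 × ZMod 2) :
    expSum D.group μ (D.rot a.1.val a.2.val) =
      LinearMap.trace ℂ _ (D.coeffRep μ (Multiplicative.ofAdd a)) := by
  rw [expSum_rot _ _ (ZMod.val_lt _) (ZMod.val_lt _), trace_coeffRep,
    ← finsum_eq_sum_of_fintype, finsum_set_coe_eq_finsum_mem (shell n μ), finsum_mem_def,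
    finsum_mem_def, Set.indicator_indicator]
  have hset : {v : Euc n | v ∈ latticeSubgroup n ∧ ‖v‖ ^ 2 = μ ∧ D.rot a.1.val a.2.val v = v} =
      shell n μ ∩ {v | D.rot a.1.val a.2.val v = v} := by
    ext v
    simp [shell, and_assoc]
  rw [hset]

/-- The dimension of the invariant coefficient vectors is the average of the exponential sums,
which are the traces of the elements of the holonomy group. -/
theorem eight_mul_finrank_invariants :
    (8 : ℂ) * Module.finrank ℂ (D.coeffRep μ).invariants =
      ∑ a : ZMod 4 × ZMod 2, expSum D.group μ (D.rot a.1.val a.2.val) := by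
  have hcard : Fintype.card (Multiplicative (ZMod 4 × ZMod 2)) = 8 := by
    simp [ZMod.card]
  let _ : Invertible (Fintype.card (Multiplicative (ZMod 4 × ZMod 2)) : ℂ) :=
    invertibleOfNonzero (by rw [hcard]; norm_num)
  rw [← ((D.coeffRep μ).isProj_averageMap).trace]
  have h1 : (D.coeffRep μ).averageMap = (8 : ℂ)⁻¹ • ∑ a : Multiplicative (ZMod 4 × ZMod 2),
      D.coeffRep μ a := by
    have hinv : ⅟(Fintype.card (Multiplicative (ZMod 4 × ZMod 2)) : ℂ) = (8 : ℂ)⁻¹ := by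
      rw [invOf_eq_inv, hcard]
      norm_num
    rw [Representation.averageMap, GroupAlgebra.average, hinv, map_smul, map_sum]
    exact congrArg _ (Finset.sum_congr rfl fun a _ => Representation.asAlgebraHom_of _ _)
  rw [h1, map_smul, map_sum, smul_eq_mul, mul_inv_cancel_left₀ (by norm_num)]
  rw [← Equiv.sum_comp Multiplicative.ofAdd]
  exact Finset.sum_congr rfl fun a _ => (D.expSum_eq_trace μ a).symm

end PairData

/-! ### Eigenforms -/

section eigenforms

variable {n p : ℕ}

theorem laplacian_clm_comp {V W : Type*} [NormedAddCommGroup V] [NormedSpace ℝ V]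
    [NormedAddCommGroup W] [NormedSpace ℝ W] (L : V →L[ℝ] W) {f : Euc n → V}
    (hf : ContDiff ℝ ∞ f) : laplacian (fun x => L (f x)) = fun x => L (laplacian f x) := by
  have h1 : fderiv ℝ (fun x => L (f x)) = fun x =>
      ContinuousLinearMap.compL ℝ (Euc n) V W L (fderiv ℝ f x) := by
    funext x
    exact (L.hasFDerivAt.comp x (hf.differentiable (by simp) x).hasFDerivAt).fderiv
  funext x
  have h2 := ((ContinuousLinearMap.compL ℝ (Euc n) V W L).hasFDerivAt.comp x
    (differentiable_fderiv_of_contDiff hf x).hasFDerivAt).fderiv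
  rw [Function.comp_def] at h2
  rw [laplacian, laplacian, h1, h2, map_neg, map_sum]
  rfl

theorem laplacian_const {V : Type*} [NormedAddCommGroup V] [NormedSpace ℝ V] (w : V) :
    laplacian (fun _ : Euc n => w) = 0 := by
  funext x
  simp [laplacian]

/-- Evaluation of a `p`-form at a tuple of vectors. -/
def evalForm (m : Fin p → Euc n) : (Euc n [⋀^Fin p]→L[ℝ] ℂ) →L[ℝ] ℂ :=
  ContinuousAlternatingMap.apply ℝ (Euc n) ℂ m

/-- Pull-back of an alternating form by a linear isometry. -/
def pullback {F : Type} [NormedAddCommGroup F] [NormedSpace ℝ F] (B : Euc n ≃ₗᵢ[ℝ] Euc n)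
    (θ : Euc n [⋀^Fin p]→L[ℝ] F) : Euc n [⋀^Fin p]→L[ℝ] F :=
  θ.compContinuousLinearMap (B.toContinuousLinearEquiv : Euc n →L[ℝ] Euc n)

theorem pullback_apply {F : Type} [NormedAddCommGroup F] [NormedSpace ℝ F]
    (B : Euc n ≃ₗᵢ[ℝ] Euc n) (θ : Euc n [⋀^Fin p]→L[ℝ] F) (m : Fin p → Euc n) :
    pullback B θ m = θ fun i => B (m i) := rfl

theorem pullback_mul {F : Type} [NormedAddCommGroup F] [NormedSpace ℝ F]
    (A B : Euc n ≃ₗᵢ[ℝ] Euc n) (θ : Euc n [⋀^Fin p]→L[ℝ] F) :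
    pullback (A * B) θ = pullback B (pullback A θ) := rfl

namespace PairData

variable (D : PairData n)

theorem pullback_rot {F : Type} [NormedAddCommGroup F] [NormedSpace ℝ F]
    {θ : Euc n [⋀^Fin p]→L[ℝ] F} (h₁ : pullback D.B₁ θ = θ) (h₂ : pullback D.B₂ θ = θ)
    (i j : ℕ) : pullback (D.rot i j) θ = θ := by
  have h : ∀ {B : Euc n ≃ₗᵢ[ℝ] Euc n}, pullback B θ = θ → ∀ k : ℕ, pullback (B ^ k) θ = θ := by
    intro B hB k
    induction k with
    | zero => rfl
    | succ k ih => rw [pow_succ, pullback_mul, ih, hB]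
  rw [rot, pullback_mul, h h₁, h h₂]

theorem isSmoothForm_const {F : Type} [NormedAddCommGroup F] [NormedSpace ℝ F]
    {θ : Euc n [⋀^Fin p]→L[ℝ] F} (h₁ : pullback D.B₁ θ = θ) (h₂ : pullback D.B₂ θ = θ) :
    IsSmoothForm D.group (fun _ => θ) := by
  refine ⟨contDiff_const, fun g hg x => ?_⟩
  obtain ⟨i, -, j, -, u, -, rfl⟩ := D.exists_of_mem_group hg
  rw [linearPart_motion]
  exact D.pullback_rot h₁ h₂ i j

/-- The components of an invariant form are periodic. -/
theorem latticePeriodic_evalForm {α : PForm n p ℂ} (h : IsSmoothForm D.group α)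
    (m : Fin p → Euc n) : LatticePeriodic fun x => evalForm m (α x) := by
  intro x u hu
  have h1 := h.2 _ (D.translation_mem_group hu) x
  rw [← motion_one, linearPart_motion, motion_one, translation_apply, add_comm] at h1
  exact congrArg (evalForm m) h1

theorem laplacian_of_mem_eigenforms {lam : ℝ} {α : PForm n p ℂ}
    (h : α ∈ eigenforms D.group p lam) : laplacian α = (lam : ℂ) • α := by
  rw [← hodgeLaplacian_eq_laplacian h.1.1]
  exact h.2

theorem mem_eigenforms_iff {lam : ℝ} {α : PForm n p ℂ} :
    α ∈ eigenforms D.group p lam ↔ IsSmoothForm D.group α ∧ laplacian α = (lam : ℂ) • α :=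
  ⟨fun h => ⟨h.1, D.laplacian_of_mem_eigenforms h⟩,
    fun h => ⟨h.1, (hodgeLaplacian_eq_laplacian h.1.1).trans h.2⟩⟩

/-- The components of an eigenform are trigonometric sums. -/
theorem exists_trigSum_evalForm {lam : ℝ} {α : PForm n p ℂ} (h : α ∈ eigenforms D.group p lam)
    (m : Fin p → Euc n) : ∃ c : shell n (lam / (4 * Real.pi ^ 2)) → ℂ,
      ∀ x, α x m = trigSum c x := by
  refine exists_eq_sum_expChar (f := fun x => evalForm m (α x))
    ((evalForm m).contDiff.comp h.1.1) (D.latticePeriodic_evalForm h.1 m) ?_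
  rw [laplacian_clm_comp _ h.1.1, D.laplacian_of_mem_eigenforms h]
  rfl

/-- Harmonic forms are constant. -/
theorem eq_const_of_mem_eigenforms_zero {α : PForm n p ℂ} (h : α ∈ eigenforms D.group p 0)
    (x : Euc n) : α x = α 0 := by
  ext m
  obtain ⟨c, hc⟩ := D.exists_trigSum_evalForm h m
  rw [hc, hc, trigSum, trigSum]
  refine Finset.sum_congr rfl fun v _ => ?_
  have hv : v.1 = 0 := by
    have := v.2.2
    simpa using this
  simp [hv, expChar]

theorem pullback_of_mem_eigenforms_zero {α : PForm n p ℂ} (h : α ∈ eigenforms D.group p 0)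
    (i j : ℕ) : pullback (D.rot i j) (α 0) = α 0 := by
  have h1 := h.1.2 _ (D.motion_mem_group i j (zero_mem _)) 0
  rw [linearPart_motion, D.eq_const_of_mem_eigenforms_zero h] at h1
  exact h1

theorem const_mem_eigenforms_zero {θ : Euc n [⋀^Fin p]→L[ℝ] ℂ} (h₁ : pullback D.B₁ θ = θ)
    (h₂ : pullback D.B₂ θ = θ) : (fun _ => θ) ∈ eigenforms D.group p 0 := by
  rw [mem_eigenforms_iff, laplacian_const]
  exact ⟨D.isSmoothForm_const h₁ h₂, by simp⟩

/-- The `p`-form `f θ` for a trigonometric sum `f` and a constant form `θ`. -/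
def trigForm (μ : ℝ) (θ : Euc n [⋀^Fin p]→L[ℝ] ℂ) : (shell n μ → ℂ) →ₗ[ℂ] PForm n p ℂ where
  toFun c x := trigSum c x • θ
  map_add' c d := by
    funext x
    have h : trigSum (c + d) x = trigSum c x + trigSum d x := by
      simp [trigSum, add_mul, Finset.sum_add_distrib]
    change trigSum (c + d) x • θ = trigSum c x • θ + trigSum d x • θ
    rw [h]
    exact add_smul (trigSum c x) (trigSum d x) θ
  map_smul' r c := by
    funext x
    simp [trigSum, mul_assoc, ← Finset.mul_sum, smul_smul]

theorem trigForm_injective {μ : ℝ} {θ : Euc n [⋀^Fin p]→L[ℝ] ℂ} (hθ : θ ≠ 0) :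
    Function.Injective (trigForm μ θ) := by
  intro c d h
  refine trigSum_injective (funext fun x => ?_)
  exact smul_left_injective ℂ hθ (congrFun h x)

/-- If the `p`-forms are spanned by one invariant form `θ`, as for `p = 0` and `p = n`, then the
eigenforms are the products of `θ` with the invariant trigonometric sums. -/
theorem eigenforms_eq_map {θ : Euc n [⋀^Fin p]→L[ℝ] ℂ} {m₀ : Fin p → Euc n} (hm₀ : θ m₀ = 1)
    (hspan : ∀ η : Euc n [⋀^Fin p]→L[ℝ] ℂ, η = η m₀ • θ) (h₁ : pullback D.B₁ θ = θ)
    (h₂ : pullback D.B₂ θ = θ) (lam : ℝ) :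
    eigenforms D.group p lam =
      ((D.coeffRep (lam / (4 * Real.pi ^ 2))).invariants).map
        (trigForm (lam / (4 * Real.pi ^ 2)) θ) := by
  have hpi : 4 * Real.pi ^ 2 * (lam / (4 * Real.pi ^ 2)) = lam := by
    field_simp
  have hpull : ∀ (i j : ℕ) (c : ℂ), pullback (D.rot i j) (c • θ) = c • θ := by
    intro i j c
    conv_rhs => rw [← D.pullback_rot h₁ h₂ i j]
    rfl
  ext α
  rw [Submodule.mem_map]
  constructor
  · intro h
    obtain ⟨c, hc⟩ := D.exists_trigSum_evalForm h m₀
    have hα : ∀ x, α x = trigSum c x • θ := fun x => by rw [← hc, ← hspan]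
    refine ⟨c, (D.trigSum_invariant_iff _ c).1 fun g hg x => ?_, funext fun x => (hα x).symm⟩
    have h3 := h.1.2 g hg x
    obtain ⟨i, -, j, -, u, -, rfl⟩ := D.exists_of_mem_group hg
    rw [linearPart_motion, hα, hα] at h3
    have h4 := (hpull i j _).symm.trans h3
    have h5 := congrArg (fun η : Euc n [⋀^Fin p]→L[ℝ] ℂ => η m₀) h4
    simpa [hm₀] using h5
  · rintro ⟨c, hc, rfl⟩
    have hinv := (D.trigSum_invariant_iff _ c).2 hc
    let M : ℂ →L[ℝ] (Euc n [⋀^Fin p]→L[ℝ] ℂ) :=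
      (ContinuousLinearMap.toSpanSingleton ℂ θ).restrictScalars ℝ
    have hM : trigForm (lam / (4 * Real.pi ^ 2)) θ c = fun x => M (trigSum c x) := rfl
    rw [mem_eigenforms_iff]
    refine ⟨⟨?_, fun g hg x => ?_⟩, ?_⟩
    · rw [hM]
      exact M.contDiff.comp (contDiff_trigSum c)
    · change ContinuousAlternatingMap.compContinuousLinearMap (trigSum c (g x) • θ) _ =
        trigSum c x • θ
      rw [hinv g hg x]
      obtain ⟨i, -, j, -, u, -, rfl⟩ := D.exists_of_mem_group hg
      rw [linearPart_motion]
      exact hpull i j _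
    · rw [hM, laplacian_clm_comp M (contDiff_trigSum c), laplacian_trigSum, hpi]
      funext x
      change ((lam : ℂ) * trigSum c x) • θ = (lam : ℂ) • (trigSum c x • θ)
      rw [smul_smul]

theorem rank_eigenforms {θ : Euc n [⋀^Fin p]→L[ℝ] ℂ} {m₀ : Fin p → Euc n} (hm₀ : θ m₀ = 1)
    (hspan : ∀ η : Euc n [⋀^Fin p]→L[ℝ] ℂ, η = η m₀ • θ) (h₁ : pullback D.B₁ θ = θ)
    (h₂ : pullback D.B₂ θ = θ) (lam : ℝ) :
    Module.rank ℂ (eigenforms D.group p lam) =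
      Module.finrank ℂ (D.coeffRep (lam / (4 * Real.pi ^ 2))).invariants := by
  have hθ : θ ≠ 0 := by
    rintro rfl
    simp at hm₀
  rw [D.eigenforms_eq_map hm₀ hspan h₁ h₂, Module.finrank_eq_rank]
  exact (LinearEquiv.rank_eq (Submodule.equivMapOfInjective _ (trigForm_injective hθ) _)).symm

/-- If the `p`-forms are spanned by one invariant form, isospectrality on `p`-forms follows from the
equality of the sums over the holonomy groups of the exponential sums. -/
theorem isIsospectral_of_sum_expSum_eq (D' : PairData n) {θ : Euc n [⋀^Fin p]→L[ℝ] ℂ}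
    {m₀ : Fin p → Euc n} (hm₀ : θ m₀ = 1)
    (hspan : ∀ η : Euc n [⋀^Fin p]→L[ℝ] ℂ, η = η m₀ • θ) (h₁ : pullback D.B₁ θ = θ)
    (h₂ : pullback D.B₂ θ = θ) (h₁' : pullback D'.B₁ θ = θ) (h₂' : pullback D'.B₂ θ = θ)
    (hsum : ∀ μ, ∑ a : ZMod 4 × ZMod 2, expSum D.group μ (D.rot a.1.val a.2.val) =
      ∑ a : ZMod 4 × ZMod 2, expSum D'.group μ (D'.rot a.1.val a.2.val)) :
    IsIsospectral p D.group D'.group := by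
  intro lam
  rw [D.rank_eigenforms hm₀ hspan h₁ h₂, D'.rank_eigenforms hm₀ hspan h₁' h₂']
  have h := hsum (lam / (4 * Real.pi ^ 2))
  rw [← eight_mul_finrank_invariants, ← eight_mul_finrank_invariants] at h
  have h' := mul_left_cancel₀ (by norm_num) h
  exact_mod_cast h'

end PairData

end eigenforms

/-! ### Coordinate forms and monomial isometries -/

section coordForm

variable {n p : ℕ}

/-- The form `dx_{w 0} ∧ ⋯ ∧ dx_{w (p - 1)}`. -/
def coordForm (w : Fin p → Fin n) : Euc n [⋀^Fin p]→L[ℝ] ℝ :=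
  { (Matrix.detRowAlternating (R := ℝ) (n := Fin p)).compLinearMap
      (LinearMap.pi fun j => (EuclideanSpace.proj (w j) : Euc n →L[ℝ] ℝ).toLinearMap) with
    cont := by
      change Continuous fun m : Fin p → Euc n => Matrix.det (Matrix.of fun i j => m i (w j))
      refine Continuous.matrix_det ?_
      fun_prop }

theorem coordForm_apply (w : Fin p → Fin n) (m : Fin p → Euc n) :
    coordForm w m = Matrix.det (Matrix.of fun i j => m i (w j)) := rfl

/-- The coordinate form `dx_{w 0} ∧ ⋯ ∧ dx_{w (p - 1)}` as a complex form. -/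
def coordFormC (w : Fin p → Fin n) : Euc n [⋀^Fin p]→L[ℝ] ℂ :=
  Complex.ofRealCLM.compContinuousAlternatingMap (coordForm w)

theorem coordFormC_apply (w : Fin p → Fin n) (m : Fin p → Euc n) :
    coordFormC w m = (coordForm w m : ℂ) := rfl

/-- The tuple of standard basis vectors with indices `w`. -/
def basisTuple (w : Fin p → Fin n) : Fin p → Euc n := fun i => EuclideanSpace.single (w i) 1

theorem coordForm_basisTuple_self {w : Fin p → Fin n} (hw : Function.Injective w) :
    coordForm w (basisTuple w) = 1 := by
  rw [coordForm_apply, ← Matrix.det_one (n := Fin p)]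
  congr 1
  ext i j
  simp [basisTuple, Matrix.one_apply, hw.eq_iff, eq_comm]

theorem coordForm_basisTuple_of_notMem {w w' : Fin p → Fin n} {i : Fin p}
    (h : ∀ j, w j ≠ w' i) : coordForm w (basisTuple w') = 0 := by
  rw [coordForm_apply]
  exact Matrix.det_eq_zero_of_row_eq_zero i fun j => by simp [basisTuple, h j]

/-- `B` permutes the coordinates by `τ`, up to the signs `s`. -/
def IsMonomial (B : Euc n ≃ₗᵢ[ℝ] Euc n) (s : Fin n → ℤ) (τ : Equiv.Perm (Fin n)) : Prop :=
  ∀ (x : Euc n) (k : Fin n), B x k = s k * x (τ k)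

theorem IsMonomial.pullback_coordForm {B : Euc n ≃ₗᵢ[ℝ] Euc n} {s : Fin n → ℤ}
    {τ : Equiv.Perm (Fin n)} (hB : IsMonomial B s τ) {w : Fin p → Fin n}
    (σ : Equiv.Perm (Fin p)) (hσ : ∀ j, τ (w j) = w (σ j))
    (hs : (Equiv.Perm.sign σ : ℤ) * ∏ j, s (w j) = 1) :
    pullback B (coordForm w) = coordForm w := by
  ext m
  rw [pullback_apply, coordForm_apply, coordForm_apply]
  have h1 : (Matrix.of fun i j => B (m i) (w j)) =
      Matrix.of fun i j => (s (w j) : ℝ) *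
        (Matrix.of fun i j => m i (w j)).submatrix id σ i j := by
    ext i j
    simp [hB (m i) (w j), hσ]
  rw [h1, Matrix.det_mul_row, Matrix.det_permute', ← mul_assoc]
  have h2 : (∏ j, (s (w j) : ℝ)) * ((Equiv.Perm.sign σ : ℤ) : ℝ) = 1 := by
    rw [mul_comm]
    exact_mod_cast hs
  rw [h2, one_mul]

theorem IsMonomial.pullback_coordFormC {B : Euc n ≃ₗᵢ[ℝ] Euc n} {s : Fin n → ℤ}
    {τ : Equiv.Perm (Fin n)} (hB : IsMonomial B s τ) {w : Fin p → Fin n}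
    (σ : Equiv.Perm (Fin p)) (hσ : ∀ j, τ (w j) = w (σ j))
    (hs : (Equiv.Perm.sign σ : ℤ) * ∏ j, s (w j) = 1) :
    pullback B (coordFormC w) = coordFormC w := by
  conv_rhs => rw [coordFormC, ← hB.pullback_coordForm σ hσ hs]
  rfl

theorem IsMonomial.apply_single {B : Euc n ≃ₗᵢ[ℝ] Euc n} {s : Fin n → ℤ}
    {τ : Equiv.Perm (Fin n)} (hB : IsMonomial B s τ) (hτ : ∀ k, τ (τ k) = k) (l : Fin n) :
    B (EuclideanSpace.single l 1) = (s (τ l) : ℝ) • EuclideanSpace.single (τ l) 1 := by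
  ext k
  rw [hB]
  by_cases h : k = τ l
  · subst h
    simp [hτ]
  · have h' : τ k ≠ l := fun h' => h (by rw [← h', hτ])
    simp [h, h']

theorem IsMonomial.apply_basisTuple {B : Euc n ≃ₗᵢ[ℝ] Euc n} {s : Fin n → ℤ}
    {τ : Equiv.Perm (Fin n)} (hB : IsMonomial B s τ) (hτ : ∀ k, τ (τ k) = k)
    {θ : Euc n [⋀^Fin p]→L[ℝ] ℂ} (hθ : pullback B θ = θ) (w : Fin p → Fin n) :
    θ (basisTuple w) = ((∏ i, s (τ (w i)) : ℤ) : ℂ) * θ (basisTuple (τ ∘ w)) := by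
  conv_lhs => rw [← hθ, pullback_apply]
  have h : (fun i => B (basisTuple w i)) =
      fun i => (s (τ (w i)) : ℝ) • basisTuple (τ ∘ w) i :=
    funext fun i => hB.apply_single hτ (w i)
  rw [h, ContinuousAlternatingMap.map_smul_univ, ← Int.cast_prod]
  simp

/-- An alternating form is determined by its values on basis vectors. -/
theorem eq_of_forall_basisTuple {θ η : Euc n [⋀^Fin p]→L[ℝ] ℂ}
    (h : ∀ w : Fin p → Fin n, Function.Injective w → θ (basisTuple w) = η (basisTuple w)) :
    θ = η := by
  apply ContinuousAlternatingMap.toAlternatingMap_injective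
  refine Module.Basis.ext_alternating (EuclideanSpace.basisFun (Fin n) ℝ).toBasis fun w hw => ?_
  have h' : (θ fun i => EuclideanSpace.single (w i) 1) = η fun i => EuclideanSpace.single (w i) 1 :=
    h w hw
  simpa using h'

theorem apply_basisTuple_perm (θ : Euc n [⋀^Fin p]→L[ℝ] ℂ) (w : Fin p → Fin n)
    (σ : Equiv.Perm (Fin p)) :
    θ (basisTuple (w ∘ σ)) = ((Equiv.Perm.sign σ : ℤ) : ℂ) * θ (basisTuple w) := by
  have h := θ.toAlternatingMap.map_perm (basisTuple w) σ
  rw [Units.smul_def, zsmul_eq_mul] at h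
  exact h

/-- The vanishing of a component only depends on the set of its indices. -/
theorem apply_basisTuple_eq_zero_of_image_eq (θ : Euc n [⋀^Fin p]→L[ℝ] ℂ)
    {w w' : Fin p → Fin n} (hw : Function.Injective w)
    (h : Finset.univ.image w = Finset.univ.image w') (h0 : θ (basisTuple w') = 0) :
    θ (basisTuple w) = 0 := by
  have h1 : ∀ i, ∃ j, w' j = w i := fun i => by
    have : w i ∈ Finset.univ.image w' := h ▸ Finset.mem_image_of_mem w (Finset.mem_univ i)
    simpa using this
  choose σ hσ using h1
  have hinj : Function.Injective σ := fun a b hab => hw (by rw [← hσ, ← hσ, hab])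
  have h2 : w = w' ∘ Equiv.ofBijective σ (Finite.injective_iff_bijective.1 hinj) :=
    funext fun i => (hσ i).symm
  rw [h2, apply_basisTuple_perm, h0, mul_zero]

/-- The top-degree forms are multiples of the volume form. -/
theorem eq_smul_coordFormC_id (θ : Euc n [⋀^Fin n]→L[ℝ] ℂ) :
    θ = θ (basisTuple id) • coordFormC id := by
  refine eq_of_forall_basisTuple fun w hw => ?_
  have h : w = id ∘ Equiv.ofBijective w (Finite.injective_iff_bijective.1 hw) := rfl
  rw [ContinuousAlternatingMap.smul_apply, h, apply_basisTuple_perm, apply_basisTuple_perm,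
    coordFormC_apply, coordForm_basisTuple_self Function.injective_id]
  simp [mul_comm]

end coordForm

section betti

variable {n p : ℕ} (D : PairData n)

/-- Invariant coordinate forms with distinct index sets are linearly independent harmonic
forms. -/
theorem PairData.le_rank_eigenforms_zero {k : ℕ} (w : Fin k → Fin p → Fin n)
    (hw : ∀ l, Function.Injective (w l)) (hne : ∀ l l', l ≠ l' → ∃ i, ∀ j, w l j ≠ w l' i)
    (h₁ : ∀ l, pullback D.B₁ (coordFormC (w l)) = coordFormC (w l))
    (h₂ : ∀ l, pullback D.B₂ (coordFormC (w l)) = coordFormC (w l)) :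
    (k : Cardinal) ≤ Module.rank ℂ (eigenforms D.group p 0) := by
  let v : Fin k → eigenforms D.group p 0 := fun l =>
    ⟨fun _ => coordFormC (w l), D.const_mem_eigenforms_zero (h₁ l) (h₂ l)⟩
  let f : Fin k → Module.Dual ℂ (eigenforms D.group p 0) := fun l =>
    { toFun := fun α => α.1 0 (basisTuple (w l))
      map_add' := fun _ _ => rfl
      map_smul' := fun _ _ => rfl }
  have hli : LinearIndependent ℂ v := by
    refine LinearIndependent.of_pairwise_dual_eq_zero_one v f ?_ ?_
    · intro l l' hll
      obtain ⟨i, hi⟩ := hne l' l hll.symm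
      change coordFormC (w l') (basisTuple (w l)) = 0
      rw [coordFormC_apply, coordForm_basisTuple_of_notMem hi, Complex.ofReal_zero]
    · intro l
      change coordFormC (w l) (basisTuple (w l)) = 1
      rw [coordFormC_apply, coordForm_basisTuple_self (hw l), Complex.ofReal_one]
  simpa using hli.cardinal_le_rank

/-- If invariant forms are determined by `k` of their components, there are at most `k` linearly
independent harmonic forms. -/
theorem PairData.rank_eigenforms_zero_le {k : ℕ} (w : Fin k → Fin p → Fin n)
    (h : ∀ θ : Euc n [⋀^Fin p]→L[ℝ] ℂ, pullback D.B₁ θ = θ → pullback D.B₂ θ = θ →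
      (∀ l, θ (basisTuple (w l)) = 0) → θ = 0) :
    Module.rank ℂ (eigenforms D.group p 0) ≤ k := by
  let f : eigenforms D.group p 0 →ₗ[ℂ] (Fin k → ℂ) :=
    { toFun := fun α l => α.1 0 (basisTuple (w l))
      map_add' := fun _ _ => rfl
      map_smul' := fun _ _ => rfl }
  have hf : Function.Injective f := by
    rw [injective_iff_map_eq_zero]
    rintro ⟨α, hα⟩ h0
    have h1 := D.pullback_of_mem_eigenforms_zero hα 1 0
    have h2 := D.pullback_of_mem_eigenforms_zero hα 0 1
    rw [D.rot_one_zero] at h1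
    rw [D.rot_zero_one] at h2
    have h3 := h (α 0) h1 h2 fun l => congrFun h0 l
    exact Subtype.ext (funext fun x => (D.eq_const_of_mem_eigenforms_zero hα x).trans h3)
  have := LinearMap.lift_rank_le_of_injective f hf
  simpa using this

end betti

/-! ### Harmonic forms on the two manifolds -/

theorem isMonomial_isoB₁ : IsMonomial isoB₁ ![1, -1, 1, -1, 1, 1]
    (Equiv.swap 0 1 * Equiv.swap 2 3) := by
  intro x k
  rw [isoB₁_apply]
  fin_cases k <;> simp [Equiv.swap_apply_def]

theorem isMonomial_isoB₂ : IsMonomial isoB₂ ![-1, -1, 1, 1, 1, 1] 1 := by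
  intro x k
  rw [isoB₂_apply]
  fin_cases k <;> simp

theorem isMonomial_isoB₁' : IsMonomial isoB₁' ![1, -1, 1, -1, -1, 1] (Equiv.swap 0 1) := by
  intro x k
  rw [isoB₁'_apply]
  fin_cases k <;> simp [Equiv.swap_apply_def]

theorem isMonomial_isoB₁'_mul_self :
    IsMonomial (isoB₁' * isoB₁') ![-1, -1, 1, 1, 1, 1] 1 := by
  intro x k
  change isoB₁' (isoB₁' x) k = _
  rw [isoB₁'_apply, isoB₁'_apply]
  fin_cases k <;> simp

theorem isMonomial_isoB₂' : IsMonomial isoB₂' ![-1, -1, -1, 1, -1, 1] 1 := by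
  intro x k
  rw [isoB₂'_apply]
  fin_cases k <;> simp

/-- A supply of harmonic forms on `M_Γ`: each index set is a union of blocks of `B₁` of
determinant `1` on which `B₂` also has determinant `1`. -/
theorem le_rank_eigenforms_groupΓ {k p : ℕ} (w : Fin k → Fin p → Fin 6)
    (σ : Fin k → Equiv.Perm (Fin p)) (hw : ∀ l, Function.Injective (w l))
    (hne : ∀ l l', l ≠ l' → ∃ i, ∀ j, w l j ≠ w l' i)
    (hσ : ∀ l j, (Equiv.swap 0 1 * Equiv.swap 2 3 : Equiv.Perm (Fin 6)) (w l j) = w l (σ l j))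
    (h₁ : ∀ l, (Equiv.Perm.sign (σ l) : ℤ) * ∏ j, ![1, -1, 1, -1, 1, 1] (w l j) = 1)
    (h₂ : ∀ l, ∏ j, (![-1, -1, 1, 1, 1, 1] : Fin 6 → ℤ) (w l j) = 1) :
    (k : Cardinal) ≤ Module.rank ℂ (eigenforms groupΓ p 0) := by
  rw [groupΓ_eq]
  refine dataΓ.le_rank_eigenforms_zero w hw hne (fun l => ?_) (fun l => ?_)
  · exact isMonomial_isoB₁.pullback_coordFormC (σ l) (hσ l) (h₁ l)
  · exact isMonomial_isoB₂.pullback_coordFormC 1 (fun j => rfl) (by simpa using h₂ l)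

/-- The component with index set `S` of a form invariant under `B₁'` and `B₂'` vanishes unless `S`
contains both or neither of `0`, `1` and the minors of `B₁'` and `B₂'` on `S` are `1`; it is enough
that these components are among the given ones. -/
theorem rank_eigenforms_groupΓ'_le {k p : ℕ} (w : Fin k → Fin p → Fin 6)
    (hS : ∀ S : Finset (Fin 6), S.card = p → (0 ∈ S ↔ 1 ∈ S) →
      (∏ s ∈ S, (![-1, -1, -1, 1, -1, 1] : Fin 6 → ℤ) s = 1) →
      (∏ s ∈ S, (![1, 1, 1, -1, -1, 1] : Fin 6 → ℤ) s = 1) → ∃ l, S = Finset.univ.image (w l)) :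
    Module.rank ℂ (eigenforms groupΓ' p 0) ≤ k := by
  rw [groupΓ'_eq]
  refine dataΓ'.rank_eigenforms_zero_le w fun θ h₁ h₂ h0 => ?_
  refine eq_of_forall_basisTuple fun v hv => ?_
  change θ (basisTuple v) = 0
  change pullback isoB₁' θ = θ at h₁
  change pullback isoB₂' θ = θ at h₂
  have h₃ : pullback (isoB₁' * isoB₁') θ = θ := by rw [pullback_mul, h₁, h₁]
  by_contra hne
  have key : ∀ {c : ℤ}, θ (basisTuple v) = (c : ℂ) * θ (basisTuple v) → c = 1 := by
    intro c hc
    have : (c : ℂ) = 1 := mul_right_cancel₀ hne (by rw [one_mul, ← hc])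
    exact_mod_cast this
  have himg : ∀ d : Fin 6 → ℤ, ∏ s ∈ Finset.univ.image v, d s = ∏ i, d (v i) := fun d =>
    Finset.prod_image fun a _ b _ hab => hv hab
  have e2 := key (isMonomial_isoB₂'.apply_basisTuple (fun _ => rfl) h₂ v)
  have e3 := key (isMonomial_isoB₁'_mul_self.apply_basisTuple (fun _ => rfl) h₃ v)
  have e1 := isMonomial_isoB₁'.apply_basisTuple (fun k => Equiv.swap_apply_self 0 1 k) h₁ v
  simp only [Equiv.Perm.one_apply] at e2 e3
  rw [← himg] at e2 e3
  rw [← himg (fun s => ![1, -1, 1, -1, -1, 1] (Equiv.swap 0 1 s))] at e1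
  have h01 : (0 ∈ Finset.univ.image v ↔ 1 ∈ Finset.univ.image v) := by
    generalize Finset.univ.image v = S at e3
    revert S
    decide
  have hd : ∏ s ∈ Finset.univ.image v, (![1, 1, 1, -1, -1, 1] : Fin 6 → ℤ) s = 1 := by
    by_cases h : (0 : Fin 6) ∈ Finset.univ.image v
    · -- the swap of the first two indices contributes a sign
      have h' := h01.1 h
      obtain ⟨a, -, ha⟩ := Finset.mem_image.1 h
      obtain ⟨b, -, hb⟩ := Finset.mem_image.1 h'
      have hab : a ≠ b := by
        rintro rfl
        rw [ha] at hb
        exact absurd hb (by decide)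
      have hsw : Equiv.swap 0 1 ∘ v = v ∘ Equiv.swap a b := by
        rw [← ha, ← hb]
        exact hv.swap_comp a b
      rw [hsw, apply_basisTuple_perm, Equiv.Perm.sign_swap hab, ← mul_assoc] at e1
      have e1' := key (c := (∏ s ∈ Finset.univ.image v,
        ![1, -1, 1, -1, -1, 1] (Equiv.swap 0 1 s)) * -1) (by
          rw [Int.cast_mul]; exact_mod_cast e1)
      clear e1 e2 hsw ha hb himg
      generalize Finset.univ.image v = S at *
      revert S
      decide
    · have h' := fun h' => h (h01.2 h')
      have hsw : Equiv.swap 0 1 ∘ v = v := by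
        funext i
        refine Equiv.swap_apply_of_ne_of_ne (fun h0 => h ?_) (fun h1 => h' ?_)
        · exact h0 ▸ Finset.mem_image_of_mem v (Finset.mem_univ i)
        · exact h1 ▸ Finset.mem_image_of_mem v (Finset.mem_univ i)
      rw [hsw] at e1
      have e1' := key e1
      clear e1 e2 hsw himg
      generalize Finset.univ.image v = S at *
      revert S
      decide
  obtain ⟨l, hl⟩ := hS _ (by rw [Finset.card_image_of_injective _ hv]; simp) h01 e2 hd
  exact hne (apply_basisTuple_eq_zero_of_image_eq θ hv hl (h0 l))

theorem not_isIsospectral_of_rank {p k : ℕ}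
    (h : ((k + 1 : ℕ) : Cardinal) ≤ Module.rank ℂ (eigenforms groupΓ p 0))
    (h' : Module.rank ℂ (eigenforms groupΓ' p 0) ≤ k) : ¬ IsIsospectral p groupΓ groupΓ' := by
  intro hiso
  have := (h.trans (hiso 0).le).trans h'
  rw [Nat.cast_le] at this
  omega

theorem not_isIsospectral_groupΓ_groupΓ' {p : ℕ} (h1 : 1 ≤ p) (h5 : p ≤ 5) :
    ¬ IsIsospectral p groupΓ groupΓ' := by
  interval_cases p
  · exact not_isIsospectral_of_rank
      (le_rank_eigenforms_groupΓ ![![4], ![5]] ![1, 1]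
        (by decide) (by decide) (by decide) (by decide) (by decide))
      (rank_eigenforms_groupΓ'_le (k := 1) ![![5]] (by decide))
  · exact not_isIsospectral_of_rank
      (le_rank_eigenforms_groupΓ ![![0, 1], ![4, 5]] ![Equiv.swap 0 1, 1]
        (by decide) (by decide) (by decide) (by decide) (by decide))
      (rank_eigenforms_groupΓ'_le (k := 1) ![![0, 1]] (by decide))
  · exact not_isIsospectral_of_rank
      (le_rank_eigenforms_groupΓ ![![0, 1, 4], ![0, 1, 5], ![2, 3, 4]]
        ![Equiv.swap 0 1, Equiv.swap 0 1, Equiv.swap 0 1]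
        (by decide) (by decide) (by decide) (by decide) (by decide))
      (rank_eigenforms_groupΓ'_le (k := 2) ![![0, 1, 5], ![2, 3, 4]] (by decide))
  · exact not_isIsospectral_of_rank
      (le_rank_eigenforms_groupΓ ![![0, 1, 2, 3], ![0, 1, 4, 5]]
        ![Equiv.swap 0 1 * Equiv.swap 2 3, Equiv.swap 0 1]
        (by decide) (by decide) (by decide) (by decide) (by decide))
      (rank_eigenforms_groupΓ'_le (k := 1) ![![2, 3, 4, 5]] (by decide))
  · exact not_isIsospectral_of_rank
      (le_rank_eigenforms_groupΓ ![![0, 1, 2, 3, 4], ![0, 1, 2, 3, 5]]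
        ![Equiv.swap 0 1 * Equiv.swap 2 3, Equiv.swap 0 1 * Equiv.swap 2 3]
        (by decide) (by decide) (by decide) (by decide) (by decide))
      (rank_eigenforms_groupΓ'_le (k := 1) ![![0, 1, 2, 3, 4]] (by decide))

/-! ### The exponential sums of the two groups -/

/-- The permutation of coordinates `x ↦ (x_{σ 0}, …, x_{σ 5})`. -/
def permCoord (σ : Equiv.Perm (Fin 6)) (x : Euc 6) : Euc 6 := WithLp.toLp 2 fun i => x (σ i)

theorem permCoord_bijective (σ : Equiv.Perm (Fin 6)) : Function.Bijective (permCoord σ) := by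
  refine Function.bijective_iff_has_inverse.2 ⟨permCoord σ⁻¹, fun x => ?_, fun x => ?_⟩ <;>
    ext i <;> simp [permCoord]

theorem permCoord_mem_latticeSubgroup (σ : Equiv.Perm (Fin 6)) (x : Euc 6) :
    permCoord σ x ∈ latticeSubgroup 6 ↔ x ∈ latticeSubgroup 6 :=
  ⟨fun h i => by simpa [permCoord] using h (σ⁻¹ i), fun h i => h (σ i)⟩

theorem norm_permCoord (σ : Equiv.Perm (Fin 6)) (x : Euc 6) : ‖permCoord σ x‖ = ‖x‖ := by
  rw [EuclideanSpace.norm_eq, EuclideanSpace.norm_eq]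
  congr 1
  exact Equiv.sum_comp σ fun i => ‖x i‖ ^ 2

/-- Two exponential sums agree if a permutation of the coordinates matches the fixed spaces of the
rotations and the pairings with the translation parts. -/
theorem expSum_eq_of_permCoord {i j k l : ℕ} (hi : i < 4) (hj : j < 2) (hk : k < 4) (hl : l < 2)
    (σ : Equiv.Perm (Fin 6))
    (hfix : ∀ x, dataΓ'.rot k l (permCoord σ x) = permCoord σ x ↔ dataΓ.rot i j x = x)
    (hinner : ∀ x, dataΓ.rot i j x = x →
      inner ℝ x (dataΓ.shift i j) = inner ℝ (permCoord σ x) (dataΓ'.shift k l)) (μ : ℝ) :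
    expSum dataΓ.group μ (dataΓ.rot i j) = expSum dataΓ'.group μ (dataΓ'.rot k l) := by
  rw [PairData.expSum_rot _ _ hi hj, PairData.expSum_rot _ _ hk hl]
  refine finsum_mem_eq_of_bijOn (permCoord σ) ⟨?_, (permCoord_bijective σ).1.injOn, ?_⟩ ?_
  · rintro x ⟨h1, h2, h3⟩
    exact ⟨(permCoord_mem_latticeSubgroup σ x).2 h1, by rw [norm_permCoord, h2], (hfix x).2 h3⟩
  · rintro y ⟨h1, h2, h3⟩
    obtain ⟨x, rfl⟩ := (permCoord_bijective σ).2 y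
    exact ⟨x, ⟨(permCoord_mem_latticeSubgroup σ x).1 h1, by rw [← h2, norm_permCoord],
      (hfix x).1 h3⟩, rfl⟩
  · rintro x ⟨h1, h2, h3⟩
    rw [expChar, expChar, hinner x h3]

theorem eq_iff_forall_six {x y : Euc 6} : x = y ↔
    x 0 = y 0 ∧ x 1 = y 1 ∧ x 2 = y 2 ∧ x 3 = y 3 ∧ x 4 = y 4 ∧ x 5 = y 5 := by
  constructor
  · rintro rfl
    simp
  · rintro ⟨h0, h1, h2, h3, h4, h5⟩
    ext i
    fin_cases i <;> assumption

theorem rotΓ_apply (i j : ℕ) (x : Euc 6) : dataΓ.rot i j x = (isoB₁ ^ i) ((isoB₂ ^ j) x) := rfl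

theorem rotΓ'_apply (i j : ℕ) (x : Euc 6) :
    dataΓ'.rot i j x = (isoB₁' ^ i) ((isoB₂' ^ j) x) := rfl

theorem inner_shiftΓ (i j : ℕ) (x : Euc 6) :
    inner ℝ x (dataΓ.shift i j) = i / 4 * x 4 + j / 2 * x 5 := by
  rw [PairData.shift, dataΓ_b₁, dataΓ_b₂, PiLp.inner_apply, Fin.sum_univ_six]
  simp
  ring

theorem inner_shiftΓ' (i j : ℕ) (x : Euc 6) :
    inner ℝ x (dataΓ'.shift i j) = i / 4 * x 5 + j / 2 * (x 3 + x 4) := by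
  rw [PairData.shift, dataΓ'_b₁, dataΓ'_b₂, PiLp.inner_apply, Fin.sum_univ_six]
  simp
  ring

/-- The coordinate permutation taking the fixed space of `B₁` to that of `B₁'`. -/
def permOdd : Equiv.Perm (Fin 6) where
  toFun := ![0, 1, 5, 2, 3, 4]
  invFun := ![0, 1, 3, 4, 5, 2]
  left_inv := by decide
  right_inv := by decide

theorem rotΓ_fixed_iff (i j : ℕ) (hi : i < 4) (hj : j < 2) (x : Euc 6) :
    dataΓ.rot i j x = x ↔ ((i ≠ 0 ∧ ¬(i = 2 ∧ j = 1) ∨ i = 0 ∧ j = 1) → x 0 = 0 ∧ x 1 = 0) ∧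
      (i ≠ 0 → x 2 = 0 ∧ x 3 = 0) := by
  rw [eq_iff_forall_six, rotΓ_apply]
  interval_cases i <;> interval_cases j <;>
    simp [pow_succ, isoB₁_apply, isoB₂_apply] <;> grind

theorem rotΓ'_fixed_iff (i j : ℕ) (hi : i < 4) (hj : j < 2) (x : Euc 6) :
    dataΓ'.rot i j x = x ↔ ((i ≠ 0 ∧ ¬(i = 2 ∧ j = 1) ∨ i = 0 ∧ j = 1) → x 0 = 0 ∧ x 1 = 0) ∧
      (j = 1 → x 2 = 0) ∧ (i % 2 = 1 → x 3 = 0) ∧ ((i + j) % 2 = 1 → x 4 = 0) := by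
  rw [eq_iff_forall_six, rotΓ'_apply]
  interval_cases i <;> interval_cases j <;>
    simp [pow_succ, isoB₁'_apply, isoB₂'_apply] <;> grind

/-- The exponential sums of `Γ` and `Γ'` agree after exchanging `B₁²` with `B₂'` and `B₂` with
`B₁'²`. For each of the eight rotations a coordinate permutation carries its fixed space onto that
of the corresponding rotation. -/
theorem expSum_rot_eq (a : ZMod 4 × ZMod 2) (μ : ℝ) :
    expSum dataΓ.group μ (dataΓ.rot a.1.val a.2.val) =
      expSum dataΓ'.group μ (dataΓ'.rot (Equiv.swap (2, 0) (0, 1) a).1.val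
        (Equiv.swap (2, 0) (0, 1) a).2.val) := by
  have main : ∀ (a b : ZMod 4 × ZMod 2) (i j k l : ℕ) (σ : Equiv.Perm (Fin 6)),
      Equiv.swap (2, 0) (0, 1) a = b → a.1.val = i → a.2.val = j → b.1.val = k → b.2.val = l →
      (∀ x, dataΓ'.rot k l (permCoord σ x) = permCoord σ x ↔ dataΓ.rot i j x = x) →
      (∀ x, dataΓ.rot i j x = x → inner ℝ x (dataΓ.shift i j) =
        inner ℝ (permCoord σ x) (dataΓ'.shift k l)) →
      expSum dataΓ.group μ (dataΓ.rot a.1.val a.2.val) =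
        expSum dataΓ'.group μ (dataΓ'.rot (Equiv.swap (2, 0) (0, 1) a).1.val
          (Equiv.swap (2, 0) (0, 1) a).2.val) := by
    rintro a b i j k l σ rfl rfl rfl rfl rfl h1 h2
    exact expSum_eq_of_permCoord (ZMod.val_lt _) (ZMod.val_lt _) (ZMod.val_lt _) (ZMod.val_lt _)
      σ h1 h2 μ
  have hperm : ∀ (σ : Equiv.Perm (Fin 6)) (x : Euc 6) (m : Fin 6), permCoord σ x m = x (σ m) :=
    fun _ _ _ => rfl
  obtain ⟨a1, a2⟩ := a
  fin_cases a1 <;> fin_cases a2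
  · refine main (0, 0) (0, 0) 0 0 0 0 1 (by decide) rfl rfl rfl rfl (fun x => ?_) (fun x hx => ?_)
    · simp [rotΓ_fixed_iff, rotΓ'_fixed_iff]
    · simp [inner_shiftΓ, inner_shiftΓ']
  · refine main (0, 1) (2, 0) 0 1 2 0 1 (by decide) rfl rfl rfl rfl (fun x => ?_) (fun x hx => ?_)
    · simp [rotΓ_fixed_iff, rotΓ'_fixed_iff, hperm]
    · simp [inner_shiftΓ, inner_shiftΓ', hperm]
      left
      norm_num
  · refine main (1, 0) (1, 0) 1 0 1 0 permOdd (by decide) rfl rfl rfl rfl (fun x => ?_)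
      (fun x hx => ?_)
    · simp [rotΓ_fixed_iff, rotΓ'_fixed_iff, hperm, permOdd]
    · simp [inner_shiftΓ, inner_shiftΓ', hperm, permOdd]
  · refine main (1, 1) (1, 1) 1 1 1 1 (Equiv.swap 4 5) (by decide) rfl rfl rfl rfl (fun x => ?_)
      (fun x hx => ?_)
    · simp [rotΓ_fixed_iff, rotΓ'_fixed_iff, hperm, Equiv.swap_apply_def]
    · simp [rotΓ_fixed_iff] at hx
      simp [inner_shiftΓ, inner_shiftΓ', hperm, Equiv.swap_apply_def, hx]
  · refine main (2, 0) (0, 1) 2 0 0 1 (Equiv.swap 3 4) (by decide) rfl rfl rfl rfl (fun x => ?_)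
      (fun x hx => ?_)
    · simp [rotΓ_fixed_iff, rotΓ'_fixed_iff, hperm, Equiv.swap_apply_def]
    · simp [rotΓ_fixed_iff] at hx
      simp [inner_shiftΓ, inner_shiftΓ', hperm, Equiv.swap_apply_def, hx]
      left
      norm_num
  · refine main (2, 1) (2, 1) 2 1 2 1 (Equiv.swap 3 4) (by decide) rfl rfl rfl rfl (fun x => ?_)
      (fun x hx => ?_)
    · simp [rotΓ_fixed_iff, rotΓ'_fixed_iff, hperm, Equiv.swap_apply_def]
    · simp [rotΓ_fixed_iff] at hx
      simp [inner_shiftΓ, inner_shiftΓ', hperm, Equiv.swap_apply_def, hx]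
      ring
  · refine main (3, 0) (3, 0) 3 0 3 0 permOdd (by decide) rfl rfl rfl rfl (fun x => ?_)
      (fun x hx => ?_)
    · simp [rotΓ_fixed_iff, rotΓ'_fixed_iff, hperm, permOdd]
    · simp [inner_shiftΓ, inner_shiftΓ', hperm, permOdd]
  · refine main (3, 1) (3, 1) 3 1 3 1 (Equiv.swap 4 5) (by decide) rfl rfl rfl rfl (fun x => ?_)
      (fun x hx => ?_)
    · simp [rotΓ_fixed_iff, rotΓ'_fixed_iff, hperm, Equiv.swap_apply_def]
    · simp [rotΓ_fixed_iff] at hx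
      simp [inner_shiftΓ, inner_shiftΓ', hperm, Equiv.swap_apply_def, hx]

/-- The bijection of the holonomy groups which preserves the exponential sums. -/
def holonomyBijection : holonomyGroup dataΓ.group ≃ holonomyGroup dataΓ'.group :=
  dataΓ.holonomyEquiv.symm.toEquiv.trans
    ((Multiplicative.ofAdd.symm.trans ((Equiv.swap (2, 0) (0, 1)).trans
      Multiplicative.ofAdd)).trans dataΓ'.holonomyEquiv.toEquiv)

theorem coe_holonomyBijection (B : holonomyGroup dataΓ.group) {a : ZMod 4 × ZMod 2}
    (h : (B : Euc 6 ≃ₗᵢ[ℝ] Euc 6) = dataΓ.rot a.1.val a.2.val) :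
    (holonomyBijection B : Euc 6 ≃ₗᵢ[ℝ] Euc 6) =
      dataΓ'.rot (Equiv.swap (2, 0) (0, 1) a).1.val (Equiv.swap (2, 0) (0, 1) a).2.val := by
  have h1 : B = dataΓ.holonomyEquiv (Multiplicative.ofAdd a) := Subtype.ext h
  have h2 : dataΓ.holonomyEquiv.symm B = Multiplicative.ofAdd a := by
    rw [h1, MulEquiv.symm_apply_apply]
  change (dataΓ'.holonomyEquiv (Multiplicative.ofAdd (Equiv.swap (2, 0) (0, 1)
    (dataΓ.holonomyEquiv.symm B).toAdd)) : Euc 6 ≃ₗᵢ[ℝ] Euc 6) = _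
  rw [h2]
  rfl

theorem exists_coe_eq_rot (B : holonomyGroup dataΓ.group) : ∃ a : ZMod 4 × ZMod 2,
    (B : Euc 6 ≃ₗᵢ[ℝ] Euc 6) = dataΓ.rot a.1.val a.2.val :=
  ⟨(dataΓ.holonomyEquiv.symm B).toAdd, by
    rw [← dataΓ.coe_holonomyEquiv, ofAdd_toAdd, MulEquiv.apply_symm_apply]⟩

theorem orderOf_rot_eq_four_iff (a : ZMod 4 × ZMod 2) :
    orderOf (dataΓ.rot a.1.val a.2.val) = 4 ↔ a.1.val % 2 = 1 := by
  have h2 : dataΓ.rot a.1.val a.2.val ^ 2 = dataΓ.rot (2 * a.1.val % 4) 0 := by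
    rw [sq, PairData.rot_mul, PairData.rot_mod]
    congr 1
    · rw [two_mul]
    · omega
  constructor
  · intro h
    by_contra hodd
    have h3 : dataΓ.rot a.1.val a.2.val ^ 2 = 1 := by
      rw [h2, show 2 * a.1.val % 4 = 0 by omega, PairData.rot_zero]
    have := orderOf_dvd_of_pow_eq_one h3
    rw [h] at this
    omega
  · intro hodd
    have h3 : 2 * a.1.val % 4 = 2 := by omega
    rw [h3] at h2
    refine orderOf_eq_prime_pow (p := 2) (n := 1) ?_ ?_
    · rw [pow_one, h2]
      intro h
      have := dataΓ.indep 2 (by norm_num) 0 (by norm_num) h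
      omega
    · change _ ^ (2 * 2) = _
      rw [pow_mul, h2, sq, PairData.rot_mul, PairData.rot_mod]
      exact dataΓ.rot_zero

theorem expChar_eq_neg_one {v x : Euc 6} {m : ℤ} (h : inner ℝ v x = m + 1 / 2) :
    expChar v x = -1 := by
  rw [expChar, h, ← Complex.exp_pi_mul_I, Complex.exp_eq_exp_iff_exists_int]
  exact ⟨m, by push_cast; ring⟩

/-- For `B` of order four the lattice vectors of squared length `8` fixed by `B` are the four
vectors `±2 e₅ ± 2 e₆`. -/
theorem expSum_eight {i j : ℕ} (hi : i < 4) (hj : j < 2) (hodd : i % 2 = 1) :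
    expSum dataΓ.group 8 (dataΓ.rot i j) = -4 := by
  rw [PairData.expSum_rot _ _ hi hj]
  let F : Finset (ℤ × ℤ) := {-2, 2} ×ˢ {-2, 2}
  let e : ℤ × ℤ → Euc 6 := fun q => !₂[0, 0, 0, 0, (q.1 : ℝ), (q.2 : ℝ)]
  have hset : {v : Euc 6 | v ∈ latticeSubgroup 6 ∧ ‖v‖ ^ 2 = 8 ∧ dataΓ.rot i j v = v} =
      e '' (F : Set (ℤ × ℤ)) := by
    ext v
    constructor
    · rintro ⟨h1, h2, h3⟩
      rw [rotΓ_fixed_iff i j hi hj] at h3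
      obtain ⟨⟨h30, h31⟩, h32, h33⟩ : (v 0 = 0 ∧ v 1 = 0) ∧ v 2 = 0 ∧ v 3 = 0 :=
        ⟨h3.1 (by omega), h3.2 (by omega)⟩
      obtain ⟨m, hm⟩ := h1 4
      obtain ⟨k, hk⟩ := h1 5
      rw [EuclideanSpace.real_norm_sq_eq, Fin.sum_univ_six, h30, h31, h32, h33, hm, hk] at h2
      have h4 : m ^ 2 + k ^ 2 = 8 := by
        have : (m : ℝ) ^ 2 + (k : ℝ) ^ 2 = 8 := by linarith
        exact_mod_cast this
      have hm1 : m ≤ 2 := by nlinarith [sq_nonneg k]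
      have hm2 : -2 ≤ m := by nlinarith [sq_nonneg k]
      have hk1 : k ≤ 2 := by nlinarith [sq_nonneg m]
      have hk2 : -2 ≤ k := by nlinarith [sq_nonneg m]
      refine ⟨(m, k), ?_, ?_⟩
      · have : (m = -2 ∨ m = 2) ∧ (k = -2 ∨ k = 2) := by
          interval_cases m <;> interval_cases k <;> simp_all
        simpa [F] using this
      · rw [eq_iff_forall_six]
        simp [e, h30, h31, h32, h33, hm, hk]
    · rintro ⟨⟨m, k⟩, hq, rfl⟩
      have hq' : (m = -2 ∨ m = 2) ∧ (k = -2 ∨ k = 2) := by simpa [F] using hq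
      refine ⟨?_, ?_, ?_⟩
      · rw [mem_latticeSubgroup_six]
        exact ⟨⟨0, by simp [e]⟩, ⟨0, by simp [e]⟩, ⟨0, by simp [e]⟩, ⟨0, by simp [e]⟩,
          ⟨m, by simp [e]⟩, ⟨k, by simp [e]⟩⟩
      · rw [EuclideanSpace.real_norm_sq_eq, Fin.sum_univ_six]
        obtain ⟨rfl | rfl, rfl | rfl⟩ := hq' <;> simp [e] <;> norm_num
      · rw [rotΓ_fixed_iff i j hi hj]
        simp [e]
  have hinj : Set.InjOn e (F : Set (ℤ × ℤ)) := by
    rintro ⟨m, k⟩ - ⟨m', k'⟩ - h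
    have h4 := congrFun (congrArg WithLp.ofLp h) 4
    have h5 := congrFun (congrArg WithLp.ofLp h) 5
    simp [e] at h4 h5
    rw [h4, h5]
  rw [hset, finsum_mem_image hinj, finsum_mem_coe_finset]
  have hval : ∀ q ∈ F, expChar (e q) (dataΓ.shift i j) = -1 := by
    rintro ⟨m, k⟩ hq
    have hq' : (m = -2 ∨ m = 2) ∧ (k = -2 ∨ k = 2) := by simpa [F] using hq
    obtain ⟨t, rfl⟩ : ∃ t, i = 2 * t + 1 := ⟨i / 2, by omega⟩
    have hin : inner ℝ (e (m, k)) (dataΓ.shift (2 * t + 1) j) =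
        ((2 * t + 1 : ℕ) : ℝ) / 4 * m + j / 2 * k := by
      rw [inner_shiftΓ]
      rfl
    obtain ⟨hm, hk⟩ := hq'
    have hk' : ∃ k' : ℤ, k = 2 * k' := by
      rcases hk with rfl | rfl
      exacts [⟨-1, rfl⟩, ⟨1, rfl⟩]
    obtain ⟨k', rfl⟩ := hk'
    rcases hm with rfl | rfl
    · refine expChar_eq_neg_one (m := -t - 1 + j * k') ?_
      rw [hin]
      push_cast
      ring
    · refine expChar_eq_neg_one (m := t + j * k') ?_
      rw [hin]
      push_cast
      ring
  rw [Finset.sum_congr rfl hval]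
  simp [F]

theorem finsum_expSum_eight :
    (∑ᶠ B ∈ {B : Euc 6 ≃ₗᵢ[ℝ] Euc 6 | B ∈ holonomyGroup dataΓ.group ∧ orderOf B = 4},
      expSum dataΓ.group 8 B) = -16 := by
  let F : Finset (ZMod 4 × ZMod 2) := Finset.univ.filter fun a => a.1.val % 2 = 1
  have hset : {B : Euc 6 ≃ₗᵢ[ℝ] Euc 6 | B ∈ holonomyGroup dataΓ.group ∧ orderOf B = 4} =
      (fun a : ZMod 4 × ZMod 2 => dataΓ.rot a.1.val a.2.val) '' (F : Set (ZMod 4 × ZMod 2)) := by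
    ext B
    constructor
    · rintro ⟨hB, h4⟩
      obtain ⟨a, ha⟩ := exists_coe_eq_rot ⟨B, hB⟩
      change B = _ at ha
      rw [ha, orderOf_rot_eq_four_iff] at h4
      exact ⟨a, by simpa [F] using h4, ha.symm⟩
    · rintro ⟨a, ha, rfl⟩
      refine ⟨dataΓ.mem_holonomyGroup.2 ⟨_, ZMod.val_lt _, _, ZMod.val_lt _, rfl⟩, ?_⟩
      rw [orderOf_rot_eq_four_iff]
      simpa [F] using ha
  have hinj : Function.Injective
      fun a : ZMod 4 × ZMod 2 => dataΓ.rot a.1.val a.2.val := by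
    intro a b h
    have := dataΓ.rot_inj (ZMod.val_lt _) (ZMod.val_lt _) (ZMod.val_lt _) (ZMod.val_lt _) h
    exact Prod.ext (ZMod.val_injective _ this.1) (ZMod.val_injective _ this.2)
  rw [hset, finsum_mem_image hinj.injOn, finsum_mem_coe_finset]
  have hval : ∀ a ∈ F, expSum dataΓ.group 8 (dataΓ.rot a.1.val a.2.val) = -4 := fun a ha =>
    expSum_eight (ZMod.val_lt _) (ZMod.val_lt _) (Finset.mem_filter.1 ha).2
  have hcard : F.card = 4 := by decide
  rw [Finset.sum_congr rfl hval, Finset.sum_const, hcard]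
  norm_num

/-! ### The two manifolds -/

theorem sum_expSum_rot_eq (μ : ℝ) :
    ∑ a : ZMod 4 × ZMod 2, expSum dataΓ.group μ (dataΓ.rot a.1.val a.2.val) =
      ∑ a : ZMod 4 × ZMod 2, expSum dataΓ'.group μ (dataΓ'.rot a.1.val a.2.val) := by
  rw [← Equiv.sum_comp (Equiv.swap ((2, 0) : ZMod 4 × ZMod 2) (0, 1))
    (fun a => expSum dataΓ'.group μ (dataΓ'.rot a.1.val a.2.val))]
  exact Finset.sum_congr rfl fun a _ => expSum_rot_eq a μ

theorem isIsospectral_zero : IsIsospectral 0 dataΓ.group dataΓ'.group := by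
  have hpull : ∀ B : Euc 6 ≃ₗᵢ[ℝ] Euc 6,
      pullback B (coordFormC (![] : Fin 0 → Fin 6)) = coordFormC ![] := by
    intro B
    ext m
    rw [pullback_apply, Subsingleton.elim (fun i => B (m i)) m]
  have h1 : coordFormC (![] : Fin 0 → Fin 6) (basisTuple ![]) = 1 := by
    rw [coordFormC_apply, coordForm_basisTuple_self (Function.injective_of_subsingleton _),
      Complex.ofReal_one]
  refine dataΓ.isIsospectral_of_sum_expSum_eq dataΓ' h1 (fun η => ?_) (hpull _) (hpull _)
    (hpull _) (hpull _) fun μ => ?_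
  · ext m
    rw [Subsingleton.elim m (basisTuple ![]), ContinuousAlternatingMap.smul_apply, h1, smul_eq_mul,
      mul_one]
  · exact sum_expSum_rot_eq μ

theorem isIsospectral_six : IsIsospectral 6 dataΓ.group dataΓ'.group := by
  refine dataΓ.isIsospectral_of_sum_expSum_eq dataΓ' (θ := coordFormC id) (m₀ := basisTuple id)
    ?_ eq_smul_coordFormC_id
    (isMonomial_isoB₁.pullback_coordFormC (Equiv.swap 0 1 * Equiv.swap 2 3) (by decide) (by decide))
    (isMonomial_isoB₂.pullback_coordFormC 1 (by decide) (by decide))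
    (isMonomial_isoB₁'.pullback_coordFormC (Equiv.swap 0 1) (by decide) (by decide))
    (isMonomial_isoB₂'.pullback_coordFormC 1 (by decide) (by decide)) fun μ => ?_
  · rw [coordFormC_apply, coordForm_basisTuple_self Function.injective_id, Complex.ofReal_one]
  · exact sum_expSum_rot_eq μ

/-- A group whose rotations preserve the volume form has an orientable quotient. -/
theorem PairData.isOrientable {n : ℕ} (D : PairData n)
    (h₁ : pullback D.B₁ (coordForm id) = coordForm id)
    (h₂ : pullback D.B₂ (coordForm id) = coordForm id) : IsOrientable D.group := by
  refine ⟨fun _ => coordForm id, D.isSmoothForm_const h₁ h₂, fun x h => ?_⟩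
  have := coordForm_basisTuple_self (n := n) Function.injective_id
  change coordForm id = 0 at h
  rw [h] at this
  simp at this

theorem isOrientable_dataΓ : IsOrientable dataΓ.group :=
  dataΓ.isOrientable
    (isMonomial_isoB₁.pullback_coordForm (Equiv.swap 0 1 * Equiv.swap 2 3) (by decide) (by decide))
    (isMonomial_isoB₂.pullback_coordForm 1 (by decide) (by decide))

theorem isOrientable_dataΓ' : IsOrientable dataΓ'.group :=
  dataΓ'.isOrientable
    (isMonomial_isoB₁'.pullback_coordForm (Equiv.swap 0 1) (by decide) (by decide))
    (isMonomial_isoB₂'.pullback_coordForm 1 (by decide) (by decide))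

theorem coe_holonomyBijection_of_eq (B : holonomyGroup dataΓ.group) {i j : ℕ} (hi : i < 4)
    (hj : j < 2) (h : (B : Euc 6 ≃ₗᵢ[ℝ] Euc 6) = isoB₁ ^ i * isoB₂ ^ j) :
    (i = 1 ∨ i = 3 ∨ (i = 2 ∧ j = 1) →
      (holonomyBijection B : Euc 6 ≃ₗᵢ[ℝ] Euc 6) = isoB₁' ^ i * isoB₂' ^ j) ∧
    (i = 2 ∧ j = 0 → (holonomyBijection B : Euc 6 ≃ₗᵢ[ℝ] Euc 6) = isoB₂') ∧
    (i = 0 ∧ j = 1 → (holonomyBijection B : Euc 6 ≃ₗᵢ[ℝ] Euc 6) = isoB₁' ^ 2) := by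
  have main : ∀ k l : ℕ, (Equiv.swap ((2, 0) : ZMod 4 × ZMod 2) (0, 1) (i, j)).1.val = k →
      (Equiv.swap ((2, 0) : ZMod 4 × ZMod 2) (0, 1) (i, j)).2.val = l →
      (holonomyBijection B : Euc 6 ≃ₗᵢ[ℝ] Euc 6) = isoB₁' ^ k * isoB₂' ^ l := by
    rintro k l rfl rfl
    refine coe_holonomyBijection B (a := ((i : ZMod 4), (j : ZMod 2))) ?_
    rw [h, ZMod.val_natCast_of_lt hi, ZMod.val_natCast_of_lt hj]
    rfl
  refine ⟨fun hij => ?_, ?_, ?_⟩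
  · refine main i j ?_ ?_ <;> interval_cases i <;> interval_cases j <;> simp at hij <;> decide
  · rintro ⟨rfl, rfl⟩
    simpa using main 0 1 (by decide) (by decide)
  · rintro ⟨rfl, rfl⟩
    simpa using main 2 0 (by decide) (by decide)

theorem expSum_eq_expSum_holonomyBijection (μ : ℝ) (B : holonomyGroup dataΓ.group) :
    expSum dataΓ.group μ B = expSum dataΓ'.group μ (holonomyBijection B) := by
  obtain ⟨a, ha⟩ := exists_coe_eq_rot B
  rw [ha, coe_holonomyBijection B ha]
  exact expSum_rot_eq a μ

end

theorem mainTheorem4 :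
    -- both groups are Bieberbach groups with translation lattice `ℤ⁶`
    (IsBieberbach groupΓ ∧ IsBieberbach groupΓ') ∧
    (translationLattice groupΓ = canonicalLattice 6 ∧
      translationLattice groupΓ' = canonicalLattice 6) ∧
    -- the orbit spaces are Hausdorff and `ℝ⁶` covers them with deck group `Γ`, resp. `Γ'`
    (T2Space (OrbitSpace groupΓ) ∧ IsQuotientCoveringMap (orbitProj groupΓ) groupΓ) ∧
    (T2Space (OrbitSpace groupΓ') ∧ IsQuotientCoveringMap (orbitProj groupΓ') groupΓ') ∧
    -- the flat manifolds are orientable with holonomy group `ℤ₄ × ℤ₂`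
    (IsOrientable groupΓ ∧ IsOrientable groupΓ') ∧
    (Nonempty (holonomyGroup groupΓ ≃* Multiplicative (ZMod 4 × ZMod 2)) ∧
      Nonempty (holonomyGroup groupΓ' ≃* Multiplicative (ZMod 4 × ZMod 2))) ∧
    -- the fundamental groups are not isomorphic
    IsEmpty (groupΓ ≃* groupΓ') ∧
    (∀ (x : OrbitSpace groupΓ) (x' : OrbitSpace groupΓ'),
      IsEmpty (FundamentalGroup (OrbitSpace groupΓ) x ≃*
        FundamentalGroup (OrbitSpace groupΓ') x')) ∧
    -- isospectral on functions and on 6-forms, but not on `p`-forms for `1 ≤ p ≤ 5`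
    IsIsospectral 0 groupΓ groupΓ' ∧
    IsIsospectral 6 groupΓ groupΓ' ∧
    (∀ p : ℕ, 1 ≤ p → p ≤ 5 → ¬ IsIsospectral p groupΓ groupΓ') ∧
    -- a bijection of the holonomy groups that preserves the exponential sums
    (∃ Φ : holonomyGroup groupΓ ≃ holonomyGroup groupΓ',
      (∀ (B : holonomyGroup groupΓ) (i j : ℕ), i < 4 → j < 2 →
        (B : Euc 6 ≃ₗᵢ[ℝ] Euc 6) = isoB₁ ^ i * isoB₂ ^ j →
        (i = 1 ∨ i = 3 ∨ (i = 2 ∧ j = 1) →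
          (Φ B : Euc 6 ≃ₗᵢ[ℝ] Euc 6) = isoB₁' ^ i * isoB₂' ^ j) ∧
        (i = 2 ∧ j = 0 → (Φ B : Euc 6 ≃ₗᵢ[ℝ] Euc 6) = isoB₂') ∧
        (i = 0 ∧ j = 1 → (Φ B : Euc 6 ≃ₗᵢ[ℝ] Euc 6) = isoB₁' ^ 2)) ∧
      ∀ (μ : ℝ) (B : holonomyGroup groupΓ), expSum groupΓ μ B = expSum groupΓ' μ (Φ B)) ∧
    -- the exponential sums at `μ = 8` over the elements of order 4
    (∑ᶠ B ∈ {B : Euc 6 ≃ₗᵢ[ℝ] Euc 6 | B ∈ holonomyGroup groupΓ ∧ orderOf B = 4},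
      expSum groupΓ 8 B) = -16 := by
  have h₁ := isEmpty_groupΓ_mulEquiv_groupΓ'
  have h₂ := isEmpty_fundamentalGroup_mulEquiv
  have h₃ : ∀ p : ℕ, 1 ≤ p → p ≤ 5 → ¬ IsIsospectral p groupΓ groupΓ' :=
    fun p => not_isIsospectral_groupΓ_groupΓ'
  rw [groupΓ_eq, groupΓ'_eq] at h₁ h₂ h₃ ⊢
  exact ⟨⟨dataΓ.isBieberbach, dataΓ'.isBieberbach⟩,
    ⟨dataΓ.translationLattice_group, dataΓ'.translationLattice_group⟩,
    ⟨dataΓ.t2Space_orbitSpace, dataΓ.isQuotientCoveringMap_orbitProj⟩,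
    ⟨dataΓ'.t2Space_orbitSpace, dataΓ'.isQuotientCoveringMap_orbitProj⟩,
    ⟨isOrientable_dataΓ, isOrientable_dataΓ'⟩,
    ⟨⟨dataΓ.holonomyEquiv.symm⟩, ⟨dataΓ'.holonomyEquiv.symm⟩⟩,
    h₁, h₂, isIsospectral_zero, isIsospectral_six, h₃,
    ⟨holonomyBijection, fun B i j => coe_holonomyBijection_of_eq B,
      expSum_eq_expSum_holonomyBijection⟩,
    finsum_expSum_eight⟩
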